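/- Let $\mathcal X$ be a measurable space, $\pi$ a probability measure on $\mathcal X$, $T\ge 1$ an integer and $h:\mathcal X^T\to\mathbb R$ a bounded measurable function. Let $P_0=\pi^{\otimes T}$, so that the coordinates $X_1,\dots,X_T$ of $\mathbf X_T$ are i.i.d. with law $\pi$ under $P_0$, and write $E_0,\mathrm{Var}_0$ for expectation and variance under $P_0$; $X,Y$ denote independent random variables with law $\pi$. For a probability measure $P$ on $\mathcal X^2$ with marginals $P_X,P_Y$, let $\phi^2(P)=\int\left(\frac{dP}{d(P_X\times P_Y)}-1\right)^2 d(P_X\times P_Y)$ (and $\phi^2(P)=\infty$ if $P\not\ll P_X\times P_Y$). For $\eta>0$ consider the problems of maximizing and of minimizing $E_f[h(\mathbf X_T)]$ over all probability measures $P_f$ on $\mathcal X^T$ such that: $P_f\ll P_0$; every $X_t$ has law $\pi$ under $P_f$; $(X_t)_{t=1}^T$ is stationary under $P_f$; $(X_t)_{t=1}^T$ is $1$-dependent under $P_f$, i.e. for every $t$, conditionally on $X_t$, $(X_s)_{s<t}$ and $(X_s)_{s>t}$ are independent; and the law of $(X_{t-1},X_t)$ under $P_f$ has $\phi^2$-coefficient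 at most $\eta$ for $t=2,\dots,T$. Put $$H(x,y)=\sum_{t=2}^T E_0[h(\mathbf X_T)\mid X_{t-1}=x,X_t=y],$$ where the conditional expectation is the version obtained by fixing $X_{t-1}=x$, $X_t=y$ and integrating the other coordinates against $\pi$, and $$R(x,y)=H(x,y)-E_0[H(X,Y)\mid X=x]-E_0[H(X,Y)\mid Y=y]+E_0[H(X,Y)].$$ Assume $\mathrm{Var}_0(R(X,Y))>0$. Then for all sufficiently small $\eta>0$ the maximum and the minimum are attained, and as $\eta\downarrow 0$ $$\max E_f[h(\mathbf X_T)]=E_0[h(\mathbf X_T)]+\Xi_1\sqrt\eta+\Xi_2\,\eta+O(\eta^{3/2}),$$ $$\min E_f[h(\mathbf X_T)]=E_0[h(\mathbf X_T)]-\Xi_1\sqrt\eta+\Xi_2\,\eta+O(\eta^{3/2}),$$ where $$\Xi_1=\sqrt{\mathrm{Var}_0(R(X,Y))},\qquad \Xi_2=\frac{\sum_{2\le s<t\le T}E_0\left[R(X_{s-1},X_s)\,R(X_{t-1},X_t)\,h(\mathbf X_T)\right]}{\mathrm{Var}_0(R(X,Y))}.$$ -/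

import Mathlib

open MeasureTheory ProbabilityTheory Filter Asymptotics
open scoped ENNReal Topology

noncomputable section

namespace SerialDependency

variable {𝒳 : Type*} [MeasurableSpace 𝒳]

/-! ### The `χ²`-distance and the `φ²`-coefficient -/

open Classical in
/-- The `χ²`-distance `χ²(P₁, P₂) = E₂[(dP₁/dP₂ - 1)²]`, with the usual convention that it is
infinite if `P₁` is not absolutely continuous with respect to `P₂`. -/
def chiSq {α : Type*} [MeasurableSpace α] (P₁ P₂ : Measure α) : ℝ≥0∞ :=
  if P₁ ≪ P₂ then ∫⁻ a, ENNReal.ofReal (((P₁.rnDeriv P₂ a).toReal - 1) ^ 2) ∂P₂ else ∞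

/-- The `φ²`-coefficient of a bivariate distribution: its `χ²`-distance from the product of its
two marginal distributions. -/
def phiSq (P : Measure (𝒳 × 𝒳)) : ℝ≥0∞ :=
  chiSq P ((P.map Prod.fst).prod (P.map Prod.snd))

/-! ### Processes with a finite time horizon

A process `X₁, …, X_T` with time horizon `T = n + 1` is given by its law, a measure on the path
space `Fin (n + 1) → 𝒳`; `X_t` is the coordinate map. The `n = T - 1` transitions
`(X_{t-1}, X_t)`, `t = 2, …, T`, are indexed by `i : Fin n`, the pair being
`(x i.castSucc, x i.succ)`. -/

/-- The process is stationary: shifting a block of consecutive times does not change its joint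
distribution. -/
def IsStationary {n : ℕ} (P : Measure (Fin (n + 1) → 𝒳)) : Prop :=
  ∀ (m k : ℕ) (hmk : m + k ≤ n + 1),
    P.map (fun x (i : Fin k) => x ⟨m + i, by omega⟩) =
      P.map (fun x (i : Fin k) => x ⟨i, by omega⟩)

/-- The `σ`-algebra generated by the present state `X_t`. -/
abbrev present {n : ℕ} (t : Fin (n + 1)) : MeasurableSpace (Fin (n + 1) → 𝒳) :=
  MeasurableSpace.comap (fun x => x t) inferInstance

/-- The `σ`-algebra generated by the states `X_s`, `s < t`. -/
abbrev past {n : ℕ} (t : Fin (n + 1)) : MeasurableSpace (Fin (n + 1) → 𝒳) :=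
  ⨆ s : {s : Fin (n + 1) // s < t}, present s.1

/-- The `σ`-algebra generated by the states `X_s`, `s > t`. -/
abbrev future {n : ℕ} (t : Fin (n + 1)) : MeasurableSpace (Fin (n + 1) → 𝒳) :=
  ⨆ s : {s : Fin (n + 1) // t < s}, present s.1

/-- The process is `1`-dependent: for every `t`, conditionally on `X_t`, the past
`(X_s)_{s < t}` and the future `(X_s)_{s > t}` are independent. Conditional independence is
written out through conditional probabilities, so that no topological assumption on the state
space is needed. -/
def IsOneDependent {n : ℕ} (P : Measure (Fin (n + 1) → 𝒳)) : Prop :=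
  ∀ (t : Fin (n + 1)) (A B : Set (Fin (n + 1) → 𝒳)),
    MeasurableSet[past t] A → MeasurableSet[future t] B →
      P⟦A ∩ B | present t⟧ =ᵐ[P] P⟦A | present t⟧ * P⟦B | present t⟧

/-- The baseline model: `X₁, …, X_T` are i.i.d. with distribution `π`. -/
def baseline (π : Measure 𝒳) (n : ℕ) : Measure (Fin (n + 1) → 𝒳) :=
  Measure.pi fun _ => π

/-! ### The optimization problems -/

/-- The feasible laws: stationary `1`-dependent processes, absolutely continuous with respect to
the baseline, with the baseline marginal distributions, and with `φ²`-coefficient of consecutive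
states at most `η`. -/
structure Feasible (π : Measure 𝒳) {n : ℕ} (η : ℝ) (P : Measure (Fin (n + 1) → 𝒳)) : Prop where
  isProbabilityMeasure : IsProbabilityMeasure P
  phiSq_le : ∀ i : Fin n,
    phiSq (P.map fun x => (x i.castSucc, x i.succ)) ≤ ENNReal.ofReal η
  isOneDependent : IsOneDependent P
  isStationary : IsStationary P
  marginal : ∀ t : Fin (n + 1), P.map (fun x => x t) = π
  absolutelyContinuous : P ≪ baseline π n

/-- The set of values `E_f[h(X₁, …, X_T)]` over all feasible laws. -/
def objectiveValues (π : Measure 𝒳) {n : ℕ} (h : (Fin (n + 1) → 𝒳) → ℝ) (η : ℝ) : Set ℝ :=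
  {v | ∃ P : Measure (Fin (n + 1) → 𝒳), Feasible π η P ∧ v = ∫ x, h x ∂P}

/-- The optimal value of the maximization problem. -/
def maxValue (π : Measure 𝒳) {n : ℕ} (h : (Fin (n + 1) → 𝒳) → ℝ) (η : ℝ) : ℝ :=
  sSup (objectiveValues π h η)

/-- The optimal value of the minimization problem. -/
def minValue (π : Measure 𝒳) {n : ℕ} (h : (Fin (n + 1) → 𝒳) → ℝ) (η : ℝ) : ℝ :=
  sInf (objectiveValues π h η)

/-! ### The coefficients of the expansion -/

/-- `E₀[h(X₁, …, X_T) | X_{t-1} = x, X_t = y]` for the transition `i`: the two states are fixed at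
`x` and `y`, all other states are integrated out independently under `π`. -/
def condMean (π : Measure 𝒳) {n : ℕ} (h : (Fin (n + 1) → 𝒳) → ℝ) (i : Fin n) (x y : 𝒳) : ℝ :=
  ∫ z, h (Function.update (Function.update z i.castSucc x) i.succ y) ∂(baseline π n)

/-- Resampling: replacing all but two coordinates by fresh ones preserves the i.i.d. law. -/
theorem map_resample (π : Measure 𝒳) [IsProbabilityMeasure π] {n : ℕ} (i : Fin n) :
    ((baseline π n).prod (baseline π n)).map
      (fun p => Function.update (Function.update p.2 i.castSucc (p.1 i.castSucc)) i.succ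
        (p.1 i.succ)) = baseline π n := by
  have hne : i.castSucc ≠ i.succ := Fin.castSucc_lt_succ.ne
  have hfun : (fun p : (Fin (n + 1) → 𝒳) × (Fin (n + 1) → 𝒳) =>
      Function.update (Function.update p.2 i.castSucc (p.1 i.castSucc)) i.succ (p.1 i.succ)) =
      fun p j => if j = i.castSucc ∨ j = i.succ then p.1 j else p.2 j := by
    funext p j
    by_cases h1 : j = i.succ
    · subst h1; simp
    · by_cases h2 : j = i.castSucc
      · subst h2; simp [hne]
      · simp [h1, h2]
  have hm : Measurable (fun (p : (Fin (n + 1) → 𝒳) × (Fin (n + 1) → 𝒳)) j =>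
      if j = i.castSucc ∨ j = i.succ then p.1 j else p.2 j) := by
    refine measurable_pi_lambda _ fun j => ?_
    by_cases hj : j = i.castSucc ∨ j = i.succ
    · simp only [hj, if_true]; fun_prop
    · simp only [hj, if_false]; fun_prop
  rw [hfun]
  have : IsProbabilityMeasure (baseline π n) := by unfold baseline; infer_instance
  refine (Measure.pi_eq fun s hs => ?_).symm
  rw [Measure.map_apply hm (MeasurableSet.univ_pi hs)]
  have hpre : (fun (p : (Fin (n + 1) → 𝒳) × (Fin (n + 1) → 𝒳)) j =>
      if j = i.castSucc ∨ j = i.succ then p.1 j else p.2 j) ⁻¹' (Set.univ.pi s) =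
      (Set.univ.pi fun j => if j = i.castSucc ∨ j = i.succ then s j else Set.univ) ×ˢ
      (Set.univ.pi fun j => if j = i.castSucc ∨ j = i.succ then Set.univ else s j) := by
    ext p
    simp only [Set.mem_preimage, Set.mem_pi, Set.mem_univ, true_imp_iff, Set.mem_prod]
    rw [← forall_and]
    refine forall_congr' fun j => ?_
    split_ifs <;> simp
  rw [hpre, Measure.prod_prod, baseline, Measure.pi_pi, Measure.pi_pi, ← Finset.prod_mul_distrib]
  refine Finset.prod_congr rfl fun j _ => ?_
  split_ifs <;> simp

/-- `condMean` is a version of the conditional expectation it stands for. -/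
theorem condExp_ae_eq_condMean (π : Measure 𝒳) [IsProbabilityMeasure π] {n : ℕ}
    (h : (Fin (n + 1) → 𝒳) → ℝ) (h_meas : Measurable h) (h_bdd : ∃ C : ℝ, ∀ x, |h x| ≤ C)
    (i : Fin n) :
    (baseline π n)[h | MeasurableSpace.comap (fun x => (x i.castSucc, x i.succ)) inferInstance]
      =ᵐ[baseline π n] fun x => condMean π h i (x i.castSucc) (x i.succ) := by
  obtain ⟨C, hC⟩ := h_bdd
  have : IsProbabilityMeasure (baseline π n) := by unfold baseline; infer_instance
  have hne : i.castSucc ≠ i.succ := Fin.castSucc_lt_succ.ne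
  have hpair : Measurable fun x : Fin (n + 1) → 𝒳 => (x i.castSucc, x i.succ) := by fun_prop
  have hint : Integrable h (baseline π n) :=
    Integrable.of_bound h_meas.aestronglyMeasurable C (ae_of_all _ hC)
  have hm3 : Measurable fun q : (𝒳 × 𝒳) × (Fin (n + 1) → 𝒳) =>
      Function.update (Function.update q.2 i.castSucc q.1.1) i.succ q.1.2 := by
    refine measurable_pi_lambda _ fun j => ?_
    by_cases h1 : j = i.succ
    · subst h1; simp; fun_prop
    · by_cases h2 : j = i.castSucc
      · subst h2; simp [hne]; fun_prop
      · simp [h1, h2]; fun_prop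
  have hcm : Measurable fun q : 𝒳 × 𝒳 => condMean π h i q.1 q.2 :=
    (StronglyMeasurable.integral_prod_right'
      (h_meas.comp hm3).stronglyMeasurable).measurable
  have hcb : ∀ x y, |condMean π h i x y| ≤ C := fun x y => by
    have := norm_integral_le_of_norm_le_const (μ := baseline π n) (C := C)
      (f := fun z => h (Function.update (Function.update z i.castSucc x) i.succ y))
      (ae_of_all _ fun z => hC _)
    simpa [condMean] using this
  refine (ae_eq_condExp_of_forall_setIntegral_eq hpair.comap_le hint
    (fun s _ _ => (Integrable.of_bound (hcm.comp hpair).aestronglyMeasurable C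
      (ae_of_all _ fun x => hcb _ _)).integrableOn) ?_ ?_).symm
  · rintro _ ⟨S, hS, rfl⟩ -
    have hS' := hpair hS
    rw [← integral_indicator hS', ← integral_indicator hS']
    conv_rhs => rw [← map_resample π i]
    have hΦ : Measurable fun p : (Fin (n + 1) → 𝒳) × (Fin (n + 1) → 𝒳) =>
        Function.update (Function.update p.2 i.castSucc (p.1 i.castSucc)) i.succ (p.1 i.succ) :=
      hm3.comp ((hpair.comp measurable_fst).prodMk measurable_snd)
    rw [integral_map hΦ.aemeasurable (h_meas.indicator hS').aestronglyMeasurable,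
      integral_prod]
    · refine integral_congr_ae (ae_of_all _ fun x => ?_)
      by_cases hx : (x i.castSucc, x i.succ) ∈ S
      · simp [Set.indicator, hx, hne, condMean]
      · simp [Set.indicator, hx, hne]
    · exact Integrable.of_bound ((h_meas.indicator hS').comp hΦ).aestronglyMeasurable C
        (ae_of_all _ fun p => (norm_indicator_le_norm_self _ _).trans (hC _))
  · exact (hcm.comp (comap_measurable _)).aestronglyMeasurable

/-- `H(x, y) = ∑_{t=2}^T E₀[h(X₁, …, X_T) | X_{t-1} = x, X_t = y]`. -/
def H (π : Measure 𝒳) {n : ℕ} (h : (Fin (n + 1) → 𝒳) → ℝ) (x y : 𝒳) : ℝ :=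
  ∑ i : Fin n, condMean π h i x y

/-- The interaction part
`R(x, y) = H(x, y) - E₀[H(X, Y) | X = x] - E₀[H(X, Y) | Y = y] + E₀[H(X, Y)]` of `H`, where `X` and
`Y` are independent with distribution `π`. -/
def R (π : Measure 𝒳) {n : ℕ} (h : (Fin (n + 1) → 𝒳) → ℝ) (x y : 𝒳) : ℝ :=
  H π h x y - ∫ y', H π h x y' ∂π - ∫ x', H π h x' y ∂π +
    ∫ p : 𝒳 × 𝒳, H π h p.1 p.2 ∂(π.prod π)

/-- `Var₀(R(X, Y))`, where `X` and `Y` are independent with distribution `π`. -/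
def varR (π : Measure 𝒳) {n : ℕ} (h : (Fin (n + 1) → 𝒳) → ℝ) : ℝ :=
  variance (fun p : 𝒳 × 𝒳 => R π h p.1 p.2) (π.prod π)

/-- `Ξ₁ = √Var₀(R(X, Y))`. -/
def Xi₁ (π : Measure 𝒳) {n : ℕ} (h : (Fin (n + 1) → 𝒳) → ℝ) : ℝ :=
  √(varR π h)

/-- `Ξ₂ = (∑_{s<t} E₀[R(X_{s-1}, X_s) R(X_{t-1}, X_t) h(X₁, …, X_T)]) / Var₀(R(X, Y))`, the sum
being over all pairs of transitions `s < t`. -/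
def Xi₂ (π : Measure 𝒳) {n : ℕ} (h : (Fin (n + 1) → 𝒳) → ℝ) : ℝ :=
  (∑ t : Fin n, ∑ s ∈ Finset.univ.filter (fun s : Fin n => s < t),
    ∫ x, R π h (x s.castSucc) (x s.succ) * R π h (x t.castSucc) (x t.succ) * h x
      ∂(baseline π n)) / varR π h

end SerialDependency

end

/-! A feasible law is determined by the joint law of two consecutive states: it is the Markov chain
whose transitions have some joint density `1 + w` with respect to `π × π`. Here `w` ranges over the
degenerate functions with `1 + w ≥ 0`, a closed convex set `K` in `L²(π × π)`, the constraint on the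
`φ²`-coefficient reads `‖w‖ ≤ √η`, and the objective is the polynomial
`F w = E₀[h(X) ∏ᵢ (1 + w(Xᵢ, Xᵢ₊₁))]`, whose gradient at `0` along `K` is `R`.

The ball constraint is uniformly convex, with curvature of order `1 / √η`, and `F` is smooth, so for
small `η` the midpoint of two points of `K ∩ {‖w‖ ≤ √η}` can be pushed towards `R` so as to gain a
multiple of their squared distance divided by `√η`. Hence maximizing sequences are Cauchy, which
gives attainment without compactness, and moving the maximizer of the linear part,
`(√η / ‖R‖) R`, to the maximizer of `F` gains only `O(η^(3/2))`. The expansion is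
therefore that of `F` along the ray spanned by `R`, where the coefficients of `√η` and `η` are read
off the product. The minimum is the case of `-h`. -/

noncomputable section

namespace SerialDependency

/-! ### Maximization over convex subsets of small balls -/

section Maximization

/-- `F` is uniformly improvable on `A`: any two points of `A` can be traded for a single point of
`A` whose value exceeds their average value by `c` times their squared distance. This is uniform
midpoint concavity with the midpoint replaced by an arbitrary point of `A`. -/
def UniformlyImprovableOn {X : Type*} [Dist X] (F : X → ℝ) (A : Set X) (c : ℝ) : Prop :=
  ∀ v ∈ A, ∀ w ∈ A, ∃ u ∈ A, (F v + F w) / 2 + c * dist v w ^ 2 ≤ F u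

theorem UniformlyImprovableOn.cauchySeq_of_tendsto {X : Type*} [PseudoMetricSpace X] {F : X → ℝ}
    {A : Set X} {c M : ℝ} (hF : UniformlyImprovableOn F A c) (hc : 0 < c) (hM : ∀ v ∈ A, F v ≤ M)
    {w : ℕ → X} (hwA : ∀ k, w k ∈ A) (hw : ∀ k : ℕ, M - 1 / ((k : ℝ) + 1) < F (w k)) :
    CauchySeq w := by
  have hdist : ∀ k l N : ℕ, N ≤ k → N ≤ l →
      dist (w k) (w l) ≤ √(1 / c * (1 / ((N : ℝ) + 1))) := fun k l N hk hl => by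
    obtain ⟨u, hu, hle⟩ := hF _ (hwA k) _ (hwA l)
    have hkN : 1 / ((k : ℝ) + 1) ≤ 1 / ((N : ℝ) + 1) := by gcongr
    have hlN : 1 / ((l : ℝ) + 1) ≤ 1 / ((N : ℝ) + 1) := by gcongr
    refine Real.le_sqrt_of_sq_le ?_
    rw [one_div_mul_eq_div, le_div_iff₀' hc]
    linarith [hM u hu, hw k, hw l]
  refine cauchySeq_of_le_tendsto_0 _ hdist ?_
  simpa using (tendsto_one_div_add_atTop_nhds_zero_nat.const_mul (1 / c)).sqrt

theorem UniformlyImprovableOn.exists_isMaxOn {X : Type*} [PseudoMetricSpace X] {F : X → ℝ}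
    {A : Set X} {c : ℝ} (hF : UniformlyImprovableOn F A c) (hc : 0 < c) (hA : IsComplete A)
    (hne : A.Nonempty) (hcont : ContinuousOn F A) (hbdd : BddAbove (F '' A)) :
    ∃ x ∈ A, IsMaxOn F A x := by
  set M := sSup (F '' A)
  have hM : ∀ v ∈ A, F v ≤ M := fun v hv => le_csSup hbdd ⟨v, hv, rfl⟩
  have hseq : ∀ k : ℕ, ∃ w ∈ A, M - 1 / ((k : ℝ) + 1) < F w := fun k => by
    simpa using
      exists_lt_of_lt_csSup (hne.image F) (sub_lt_self M (Nat.one_div_pos_of_nat (n := k)))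
  choose w hwA hw using hseq
  obtain ⟨x, hxA, hx⟩ :=
    cauchySeq_tendsto_of_isComplete hA hwA (hF.cauchySeq_of_tendsto hc hM hwA hw)
  have hFw : Tendsto (fun k => F (w k)) atTop (𝓝 (F x)) :=
    (hcont x hxA).tendsto.comp (tendsto_nhdsWithin_iff.2 ⟨hx, Eventually.of_forall hwA⟩)
  have hMk : Tendsto (fun k : ℕ => M - 1 / ((k : ℝ) + 1)) atTop (𝓝 M) := by
    simpa using tendsto_one_div_add_atTop_nhds_zero_nat.const_sub M
  exact ⟨x, hxA, fun v hv =>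
    (hM v hv).trans (le_of_tendsto_of_tendsto hMk hFw (Eventually.of_forall fun k => (hw k).le))⟩

theorem UniformlyImprovableOn.sub_le_of_isMaxOn {X : Type*} [PseudoMetricSpace X] {F : X → ℝ}
    {A : Set X} {c κ : ℝ} (hF : UniformlyImprovableOn F A c) (hc : 0 < c) {x z : X} (hx : x ∈ A)
    (hz : z ∈ A) (hmax : IsMaxOn F A x) (hκ : F x - F z ≤ κ * dist x z) :
    F x - F z ≤ κ ^ 2 / (2 * c) := by
  obtain ⟨u, hu, hle⟩ := hF x hx z hz
  have hxz : 2 * c * dist x z ^ 2 ≤ F x - F z := by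
    linarith [isMaxOn_iff.1 hmax u hu]
  -- `κ d - c d² ≤ κ² / (4 c)` with `d = dist x z`
  rw [le_div_iff₀ (by positivity)]
  nlinarith [sq_nonneg (κ - 2 * c * dist x z)]

variable {E : Type*} [NormedAddCommGroup E]

section NormedSpace

variable [NormedSpace ℝ E]

theorem norm_image_sub_sub_fderiv_le {G : Type*} [NormedAddCommGroup G] [NormedSpace ℝ G]
    {f : E → G} {s : Set E} {L : NNReal} (hs : Convex ℝ s) (hf : ∀ x ∈ s, DifferentiableAt ℝ f x)
    (hL : LipschitzOnWith L (fderiv ℝ f) s) {a u v : E} {ρ : ℝ} (ha : a ∈ s) (hu : u ∈ s)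
    (hv : v ∈ s) (hua : dist u a ≤ ρ) (hva : dist v a ≤ ρ) :
    ‖f u - f v - fderiv ℝ f a (u - v)‖ ≤ L * ρ * ‖u - v‖ :=
  (hs.inter (convex_closedBall a ρ)).norm_image_sub_le_of_norm_hasFDerivWithin_le'
    (fun x hx => (hf x hx.1).hasFDerivAt.hasFDerivWithinAt)
    (fun x hx => by
      rw [← dist_eq_norm]
      exact (hL.dist_le_mul x hx.1 a ha).trans (by gcongr; exact hx.2))
    ⟨hv, hva⟩ ⟨hu, hua⟩

theorem average_sub_le_image_midpoint {F : E → ℝ} {s : Set E} {L : NNReal} (hs : Convex ℝ s)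
    (hF : ∀ x ∈ s, DifferentiableAt ℝ F x) (hL : LipschitzOnWith L (fderiv ℝ F) s) {u v : E}
    (hu : u ∈ s) (hv : v ∈ s) :
    (F u + F v) / 2 - L / 4 * ‖u - v‖ ^ 2 ≤ F (midpoint ℝ u v) := by
  set m := midpoint ℝ u v
  have hm : m ∈ s := hs.midpoint_mem hu hv
  have hum : dist u m = ‖u - v‖ / 2 := by
    rw [dist_left_midpoint, dist_eq_norm, Real.norm_ofNat]; ring
  have hvm : dist v m = ‖u - v‖ / 2 := by
    rw [dist_right_midpoint, dist_eq_norm, Real.norm_ofNat]; ring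
  have hu' := norm_image_sub_sub_fderiv_le hs hF hL hm hu hm hum.le
    ((dist_self m).trans_le (by positivity))
  have hv' := norm_image_sub_sub_fderiv_le hs hF hL hm hv hm hvm.le
    ((dist_self m).trans_le (by positivity))
  have hsymm : fderiv ℝ F m (v - m) = -fderiv ℝ F m (u - m) := by
    rw [← map_neg, neg_sub]
    congr 1
    rw [sub_eq_sub_iff_add_eq_add, midpoint_add_self, add_comm]
  rw [← dist_eq_norm u m, hum, Real.norm_eq_abs, abs_le] at hu'
  rw [← dist_eq_norm v m, hvm, hsymm, Real.norm_eq_abs, abs_le] at hv'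
  linarith [hu'.2, hv'.2]

end NormedSpace

variable [InnerProductSpace ℝ E]

theorem norm_midpoint_le_sub {ρ : ℝ} (hρ : 0 < ρ) {v w : E} (hv : ‖v‖ ≤ ρ) (hw : ‖w‖ ≤ ρ) :
    ‖midpoint ℝ v w‖ ≤ ρ - ‖v - w‖ ^ 2 / (8 * ρ) := by
  have hmid : 2 * ‖midpoint ℝ v w‖ = ‖v + w‖ := by
    rw [← midpoint_add_self ℝ v w, ← two_smul ℝ, norm_smul, Real.norm_ofNat]
  have hpar := parallelogram_law_with_norm ℝ v w
  have hsq : ‖midpoint ℝ v w‖ ^ 2 ≤ ρ ^ 2 - ‖v - w‖ ^ 2 / 4 := by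
    have hv2 : ‖v‖ ^ 2 ≤ ρ ^ 2 := by gcongr
    have hw2 : ‖w‖ ^ 2 ≤ ρ ^ 2 := by gcongr
    rw [← hmid] at hpar
    linarith
  have hmρ : ‖midpoint ℝ v w‖ ≤ ρ := by linarith [norm_add_le v w]
  rw [le_sub_iff_add_le, ← le_sub_iff_add_le', div_le_iff₀ (by positivity)]
  nlinarith [norm_nonneg (midpoint ℝ v w)]

theorem norm_div_norm_smul {ρ : ℝ} (hρ : 0 ≤ ρ) {r : E} (hr : r ≠ 0) : ‖(ρ / ‖r‖) • r‖ = ρ := by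
  rw [norm_smul, Real.norm_of_nonneg (by positivity), div_mul_cancel₀ _ (norm_ne_zero_iff.2 hr)]

theorem inner_div_norm_smul (ρ : ℝ) (r : E) : inner ℝ r ((ρ / ‖r‖) • r) = ‖r‖ * ρ := by
  rw [inner_smul_right, real_inner_self_eq_norm_sq]
  rcases eq_or_ne ‖r‖ 0 with h | h
  · simp [h]
  · field_simp

variable {F : E → ℝ} {K : Set E} {r : E} {L : NNReal} {δ ρ : ℝ}

theorem add_le_image_lineMap (hF : ∀ x ∈ Metric.ball (0 : E) δ, DifferentiableAt ℝ F x)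
    (hL : LipschitzOnWith L (fderiv ℝ F) (Metric.ball 0 δ)) (hr : r ≠ 0)
    (hgrad : ∀ w ∈ K, fderiv ℝ F 0 w = inner ℝ r w) (hρ : 0 < ρ) (hρδ : ρ < δ)
    (hrK : (2 * ρ / ‖r‖) • r ∈ K) {m : E} (hmK : m ∈ K) (hm : ‖m‖ ≤ ρ) {s : ℝ} (hs : 0 ≤ s)
    (hu : ‖AffineMap.lineMap m ((2 * ρ / ‖r‖) • r) s‖ ≤ ρ) :
    F m + s * ρ * (‖r‖ - 3 * L * ρ) ≤ F (AffineMap.lineMap m ((2 * ρ / ‖r‖) • r) s) := by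
  set p := (2 * ρ / ‖r‖) • r
  set u := AffineMap.lineMap m p s with hu_def
  have hum : u - m = s • (p - m) := by rw [hu_def, AffineMap.lineMap_apply_module']; abel
  have hpn : ‖p‖ = 2 * ρ := norm_div_norm_smul (by positivity) hr
  have hpr : inner ℝ r p = ‖r‖ * (2 * ρ) := inner_div_norm_smul _ r
  have hball := Metric.closedBall_subset_ball (x := (0 : E)) hρδ
  rw [← mem_closedBall_zero_iff] at hu
  have hm' : m ∈ Metric.closedBall (0 : E) ρ := mem_closedBall_zero_iff.2 hm
  have hmove := norm_image_sub_sub_fderiv_le (convex_ball (0 : E) δ) hF hL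
    (Metric.mem_ball_self (hρ.trans hρδ)) (hball hu) (hball hm') hu hm'
  have hgain : s * (ρ * ‖r‖) ≤ fderiv ℝ F 0 (u - m) := by
    rw [hum, map_smul, map_sub, hgrad p hrK, hgrad m hmK, hpr, smul_eq_mul]
    have : inner ℝ r m ≤ ‖r‖ * ρ := (real_inner_le_norm r m).trans (by gcongr)
    gcongr
    linarith
  have hcost : L * ρ * ‖u - m‖ ≤ L * ρ * (s * (3 * ρ)) := by
    rw [hum, norm_smul, Real.norm_of_nonneg hs]
    gcongr
    exact (norm_sub_le p m).trans (by linarith)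
  linarith [(abs_le.1 hmove).1]

/- The midpoint of `v` and `w` lies in the ball of radius `ρ` at depth of the order of
`‖v - w‖² / ρ`, which leaves room to move it towards `(2 ρ / ‖r‖) r`; this gains a multiple of
`‖r‖ / ρ`, whereas the curvature of `F` costs only a multiple of `L`. -/
theorem uniformlyImprovableOn_inter_closedBall (hK : Convex ℝ K)
    (hF : ∀ x ∈ Metric.ball (0 : E) δ, DifferentiableAt ℝ F x)
    (hL : LipschitzOnWith L (fderiv ℝ F) (Metric.ball 0 δ)) (hr : r ≠ 0)
    (hgrad : ∀ w ∈ K, fderiv ℝ F 0 w = inner ℝ r w) (hρ : 0 < ρ) (hρδ : ρ < δ)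
    (hrK : (2 * ρ / ‖r‖) • r ∈ K) (hρL : 14 * L * ρ ≤ ‖r‖) :
    UniformlyImprovableOn F (K ∩ Metric.closedBall 0 ρ) (‖r‖ / (32 * ρ)) := by
  rintro v ⟨hvK, hv⟩ w ⟨hwK, hw⟩
  have hr' : 0 < ‖r‖ := norm_pos_iff.2 hr
  have hball := Metric.closedBall_subset_ball (x := (0 : E)) hρδ
  have hmid := average_sub_le_image_midpoint (convex_ball (0 : E) δ) hF hL (hball hv) (hball hw)
  rw [mem_closedBall_zero_iff] at hv hw
  set m := midpoint ℝ v w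
  have hmK : m ∈ K := hK.midpoint_mem hvK hwK
  set s := ‖v - w‖ ^ 2 / (16 * ρ ^ 2)
  have hd : ‖v - w‖ ^ 2 = 16 * ρ ^ 2 * s := by simp only [s]; field_simp
  have hs0 : 0 ≤ s := by positivity
  have hm : ‖m‖ ≤ ρ - 2 * ρ * s := by
    refine (norm_midpoint_le_sub hρ hv hw).trans_eq ?_
    rw [hd]; field_simp; ring
  have hm' : ‖m‖ ≤ ρ := hm.trans (sub_le_self _ (by positivity))
  have hs1 : s ≤ 1 := by nlinarith [norm_nonneg m]
  have hu : ‖AffineMap.lineMap m ((2 * ρ / ‖r‖) • r) s‖ ≤ ρ := by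
    rw [AffineMap.lineMap_apply_module]
    refine (norm_add_le _ _).trans ?_
    rw [norm_smul, norm_smul, Real.norm_of_nonneg hs0, Real.norm_of_nonneg (sub_nonneg.2 hs1),
      norm_div_norm_smul (by positivity) hr]
    nlinarith [norm_nonneg m]
  refine ⟨_, ⟨hK.lineMap_mem hmK hrK ⟨hs0, hs1⟩, mem_closedBall_zero_iff.2 hu⟩, ?_⟩
  have hmove := add_le_image_lineMap hF hL hr hgrad hρ hρδ hrK hmK hm' hs0 hu
  have hspare : 0 ≤ s * ρ * (‖r‖ - 14 * L * ρ) :=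
    mul_nonneg (by positivity) (sub_nonneg.2 hρL)
  have hc : ‖r‖ / (32 * ρ) * (16 * ρ ^ 2 * s) = s * ρ * ‖r‖ / 2 := by field_simp; ring
  rw [dist_eq_norm, hd, hc]
  rw [hd] at hmid
  linarith

theorem image_sub_image_smul_le (hF : ∀ x ∈ Metric.ball (0 : E) δ, DifferentiableAt ℝ F x)
    (hL : LipschitzOnWith L (fderiv ℝ F) (Metric.ball 0 δ)) (hr : r ≠ 0)
    (hgrad : ∀ w ∈ K, fderiv ℝ F 0 w = inner ℝ r w) (hρ : 0 < ρ) (hρδ : ρ < δ)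
    (hrK : (ρ / ‖r‖) • r ∈ K) {v : E} (hv : v ∈ K ∩ Metric.closedBall 0 ρ) :
    F v - F ((ρ / ‖r‖) • r) ≤ L * ρ * dist v ((ρ / ‖r‖) • r) := by
  set z := (ρ / ‖r‖) • r
  have hball := Metric.closedBall_subset_ball (x := (0 : E)) hρδ
  have hz : z ∈ Metric.closedBall (0 : E) ρ :=
    mem_closedBall_zero_iff.2 (norm_div_norm_smul hρ.le hr).le
  have hlin := norm_image_sub_sub_fderiv_le (convex_ball (0 : E) δ) hF hL
    (Metric.mem_ball_self (hρ.trans hρδ)) (hball hv.2) (hball hz) hv.2 hz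
  have hrz : inner ℝ r z = ‖r‖ * ρ := inner_div_norm_smul ρ r
  have hrv : inner ℝ r v ≤ ‖r‖ * ρ :=
    (real_inner_le_norm r v).trans (by gcongr; exact mem_closedBall_zero_iff.1 hv.2)
  rw [map_sub, hgrad v hv.1, hgrad z hrK, hrz] at hlin
  rw [dist_eq_norm]
  linarith [(abs_le.1 hlin).2]

theorem exists_isMaxOn_inter_closedBall_of_lipschitzOnWith [CompleteSpace E] (hK : Convex ℝ K)
    (hKc : IsClosed K) (hF : ∀ x ∈ Metric.ball (0 : E) δ, DifferentiableAt ℝ F x)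
    (hL : LipschitzOnWith L (fderiv ℝ F) (Metric.ball 0 δ)) (hr : r ≠ 0)
    (hgrad : ∀ w ∈ K, fderiv ℝ F 0 w = inner ℝ r w) (hρ : 0 < ρ) (hρδ : ρ < δ)
    (hzK : (ρ / ‖r‖) • r ∈ K) (hpK : (2 * ρ / ‖r‖) • r ∈ K) (hρL : 14 * L * ρ ≤ ‖r‖) :
    ∃ x ∈ K ∩ Metric.closedBall 0 ρ, IsMaxOn F (K ∩ Metric.closedBall 0 ρ) x ∧
      F x ≤ F ((ρ / ‖r‖) • r) + 16 * L ^ 2 / ‖r‖ * ρ ^ 3 := by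
  have himp := uniformlyImprovableOn_inter_closedBall hK hF hL hr hgrad hρ hρδ hpK hρL
  have hdom := fun v => image_sub_image_smul_le (v := v) hF hL hr hgrad hρ hρδ hzK
  have hc : 0 < ‖r‖ / (32 * ρ) := div_pos (norm_pos_iff.2 hr) (by positivity)
  have hz : (ρ / ‖r‖) • r ∈ K ∩ Metric.closedBall 0 ρ :=
    ⟨hzK, mem_closedBall_zero_iff.2 (norm_div_norm_smul hρ.le hr).le⟩
  have hbdd : BddAbove (F '' (K ∩ Metric.closedBall 0 ρ)) := by
    refine ⟨F ((ρ / ‖r‖) • r) + L * ρ * (ρ + ρ), Set.forall_mem_image.2 fun v hv => ?_⟩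
    rw [← sub_le_iff_le_add']
    refine (hdom v hv).trans ?_
    gcongr
    exact (dist_triangle_right v _ 0).trans (add_le_add hv.2 hz.2)
  have hcont : ContinuousOn F (K ∩ Metric.closedBall 0 ρ) := fun v hv =>
    (hF v (Metric.closedBall_subset_ball hρδ hv.2)).continuousAt.continuousWithinAt
  obtain ⟨x, hx, hmax⟩ := himp.exists_isMaxOn hc
    (hKc.inter Metric.isClosed_closedBall).isComplete ⟨_, hz⟩ hcont hbdd
  refine ⟨x, hx, hmax, ?_⟩
  have hxz := himp.sub_le_of_isMaxOn hc hx hz hmax (hdom x hx)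
  have hconst : (L * ρ) ^ 2 / (2 * (‖r‖ / (32 * ρ))) = 16 * L ^ 2 / ‖r‖ * ρ ^ 3 := by
    field_simp; ring
  linarith

theorem exists_isMaxOn_inter_closedBall_le [CompleteSpace E] (hF : ContDiff ℝ 2 F)
    (hK : Convex ℝ K) (hKc : IsClosed K) (hr : r ≠ 0)
    (hgrad : ∀ w ∈ K, fderiv ℝ F 0 w = inner ℝ r w) {t₀ : ℝ} (ht₀ : 0 < t₀)
    (hrK : ∀ t, 0 ≤ t → t ≤ t₀ → t • r ∈ K) :
    ∃ C : ℝ, ∀ᶠ ρ : ℝ in 𝓝[>] 0, (ρ / ‖r‖) • r ∈ K ∧ ∃ x ∈ K ∩ Metric.closedBall 0 ρ,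
      IsMaxOn F (K ∩ Metric.closedBall 0 ρ) x ∧ F x ≤ F ((ρ / ‖r‖) • r) + C * ρ ^ 3 := by
  have hr' : 0 < ‖r‖ := norm_pos_iff.2 hr
  obtain ⟨L, t, ht, hLt⟩ := ((hF.fderiv_right (m := 1) (by norm_num)).contDiffAt
    (x := (0 : E))).exists_lipschitzOnWith
  obtain ⟨δ, hδ, hδt⟩ := Metric.mem_nhds_iff.1 ht
  have hFd : ∀ x ∈ Metric.ball (0 : E) δ, DifferentiableAt ℝ F x := fun x _ =>
    (hF.differentiable (by norm_num)).differentiableAt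
  refine ⟨16 * L ^ 2 / ‖r‖, ?_⟩
  filter_upwards [eventually_mem_nhdsWithin,
    nhdsWithin_le_nhds (eventually_lt_nhds hδ),
    nhdsWithin_le_nhds (eventually_lt_nhds (b := t₀ * ‖r‖ / 2) (by positivity)),
    nhdsWithin_le_nhds (eventually_lt_nhds (b := ‖r‖ / (14 * L + 1)) (by positivity))]
    with ρ hρ hρδ hρt hρL
  replace hρ : 0 < ρ := hρ
  have hzK : (ρ / ‖r‖) • r ∈ K :=
    hrK _ (by positivity) (by rw [div_le_iff₀ hr']; linarith)
  have hpK : (2 * ρ / ‖r‖) • r ∈ K :=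
    hrK _ (by positivity) (by rw [div_le_iff₀ hr']; linarith)
  rw [lt_div_iff₀ (by positivity)] at hρL
  exact ⟨hzK, exists_isMaxOn_inter_closedBall_of_lipschitzOnWith hK hKc hFd (hLt.mono hδt) hr
    hgrad hρ hρδ hzK hpK (by linarith)⟩

end Maximization

/-! ### Product measures -/

section Pi

variable {ι : Type*} [Fintype ι] {X : ι → Type*} [∀ i, MeasurableSpace (X i)]
  (μ : ∀ i, Measure (X i))

/-- The mean of `g` under the product measure, conditionally on the coordinate `i` being `c`. -/
def fiberMean [DecidableEq ι] (i : ι) (g : (∀ j, X j) → ℝ≥0∞) (c : X i) : ℝ≥0∞ :=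
  ∫⁻ z, g (Function.update z i c) ∂(Measure.pi μ)

variable [∀ i, IsProbabilityMeasure (μ i)]

theorem measurable_fiberMean [DecidableEq ι] (i : ι) {g : (∀ j, X j) → ℝ≥0∞} (hg : Measurable g) :
    Measurable (fiberMean μ i g) :=
  (hg.comp measurable_update').lintegral_prod_left'

omit [Fintype ι] in
theorem measurable_piecewise_prod (s : Set ι) [DecidablePred (· ∈ s)] :
    Measurable fun q : (∀ i, X i) × (∀ i, X i) => s.piecewise q.1 q.2 := by
  refine measurable_pi_lambda _ fun i => ?_
  by_cases hi : i ∈ s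
  · simpa only [Set.piecewise_eq_of_mem _ _ _ hi] using by fun_prop
  · simpa only [Set.piecewise_eq_of_notMem _ _ _ hi] using by fun_prop

theorem measurePreserving_piecewise (s : Set ι) [DecidablePred (· ∈ s)] :
    MeasurePreserving (fun q : (∀ i, X i) × (∀ i, X i) => s.piecewise q.1 q.2)
      ((Measure.pi μ).prod (Measure.pi μ)) (Measure.pi μ) := by
  refine ⟨measurable_piecewise_prod s, (Measure.pi_eq fun t ht => ?_).symm⟩
  have hpre : (fun q : (∀ i, X i) × (∀ i, X i) => s.piecewise q.1 q.2) ⁻¹' Set.univ.pi t =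
      Set.univ.pi (s.piecewise t fun _ => Set.univ) ×ˢ
        Set.univ.pi (s.piecewise (fun _ => Set.univ) t) := by
    ext q
    simp only [Set.mem_preimage, Set.mem_prod, Set.mem_univ_pi, ← forall_and]
    refine forall_congr' fun i => ?_
    by_cases hi : i ∈ s <;> simp [hi]
  rw [Measure.map_apply (measurable_piecewise_prod s) (MeasurableSet.univ_pi ht), hpre,
    Measure.prod_prod, Measure.pi_pi, Measure.pi_pi, ← Finset.prod_mul_distrib]
  refine Finset.prod_congr rfl fun i _ => ?_
  by_cases hi : i ∈ s <;> simp [hi]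

theorem measurePreserving_eval_pair {i j : ι} (hij : i ≠ j) :
    MeasurePreserving (fun x : ∀ i, X i => (x i, x j)) (Measure.pi μ) ((μ i).prod (μ j)) := by
  have hind := (iIndepFun_pi (μ := μ) (X := fun _ => id) fun _ => aemeasurable_id).indepFun hij
  refine ⟨by fun_prop, ?_⟩
  simpa only [id_eq, (measurePreserving_eval μ _).map_eq] using
    hind.map_prod_eq_prod_map_map (measurable_pi_apply i).aemeasurable
      (measurable_pi_apply j).aemeasurable

theorem measurePreserving_comp_of_injective {κ : Type*} [Fintype κ] {e : κ → ι}
    (he : e.Injective) :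
    MeasurePreserving (fun (x : ∀ i, X i) k => x (e k)) (Measure.pi μ)
      (Measure.pi fun k => μ (e k)) := by
  have hind := (iIndepFun_pi (μ := μ) (X := fun _ => id) fun _ => aemeasurable_id).precomp he
  refine ⟨by fun_prop, ?_⟩
  simpa only [id_eq, (measurePreserving_eval μ _).map_eq] using
    hind.map_fun_eq_pi_map fun k => (measurable_pi_apply (e k)).aemeasurable

theorem lintegral_mul_eq_lintegral_mul_fiberMean [DecidableEq ι] {S : Set ι} {i : ι} (hi : i ∈ S)
    {f g : (∀ j, X j) → ℝ≥0∞} (hf : Measurable f) (hg : Measurable g) (hfS : DependsOn f S)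
    (hgS : DependsOn g (insert i Sᶜ)) :
    ∫⁻ x, f x * g x ∂(Measure.pi μ) = ∫⁻ x, f x * fiberMean μ i g (x i) ∂(Measure.pi μ) := by
  classical
  have hfg : Measurable fun x => f x * g x := hf.mul hg
  -- resample the coordinates outside `S`
  rw [← (measurePreserving_piecewise μ S).lintegral_comp hfg,
    lintegral_prod (fun q => f (S.piecewise q.1 q.2) * g (S.piecewise q.1 q.2))
      (hfg.comp (measurable_piecewise_prod S)).aemeasurable]
  refine lintegral_congr fun x => ?_
  have hfx : ∀ z, f (S.piecewise x z) = f x := fun z => hfS fun j hj => by simp [hj]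
  have hgx : ∀ z, g (S.piecewise x z) = g (Function.update z i (x i)) := fun z =>
    hgS fun j hj => by
      rcases hj with rfl | hj
      · simp [hi]
      · rw [Set.piecewise_eq_of_notMem _ _ _ hj,
          Function.update_of_ne (ne_of_mem_of_not_mem hi hj).symm]
  simp only [hfx, hgx]
  exact lintegral_const_mul _ (hg.comp measurable_update_left)

theorem lintegral_mul_eval_pair {i j : ι} (hij : i ≠ j) {f : (∀ j, X j) → ℝ≥0∞}
    {k : X i × X j → ℝ≥0∞} (hf : Measurable f) (hk : Measurable k) (hfj : DependsOn f {j}ᶜ) :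
    ∫⁻ x, f x * k (x i, x j) ∂(Measure.pi μ) =
      ∫⁻ x, f x * ∫⁻ y, k (x i, y) ∂(μ j) ∂(Measure.pi μ) := by
  classical
  rw [lintegral_mul_eq_lintegral_mul_fiberMean μ (S := {j}ᶜ) (i := i) hij hf (by fun_prop) hfj
    fun x y h => by simp [h i, h j]]
  refine lintegral_congr fun x => ?_
  rw [fiberMean, ← (measurePreserving_eval μ j).lintegral_comp (by fun_prop)]
  simp [Function.update_of_ne hij.symm]

end Pi

section Baseline

variable {𝒳 : Type*} [MeasurableSpace 𝒳] {n : ℕ} (π : Measure 𝒳) [IsProbabilityMeasure π]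

instance isProbabilityMeasure_baseline : IsProbabilityMeasure (baseline π n) := by
  unfold baseline; infer_instance

theorem measurePreserving_eval_baseline (t : Fin (n + 1)) :
    MeasurePreserving (fun x : Fin (n + 1) → 𝒳 => x t) (baseline π n) π :=
  measurePreserving_eval (fun _ => π) t

theorem measurePreserving_transition_baseline (i : Fin n) :
    MeasurePreserving (fun x : Fin (n + 1) → 𝒳 => (x i.castSucc, x i.succ)) (baseline π n)
      (π.prod π) :=
  measurePreserving_eval_pair (fun _ => π) Fin.castSucc_lt_succ.ne

end Baseline

/-! ### Products of kernels along consecutive transitions -/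

section Chain

variable {𝒳 : Type*} {n : ℕ}

/-- The transitions between the states at the times `a, …, b`. -/
def transitions (n a b : ℕ) : Finset (Fin n) := {i | a ≤ i.val ∧ i.val < b}

theorem mem_transitions {a b : ℕ} {i : Fin n} : i ∈ transitions n a b ↔ a ≤ i ∧ i < b := by
  simp [transitions]

theorem transitions_self (n a : ℕ) : transitions n a a = ∅ := by
  ext; simp [mem_transitions]

theorem transitions_zero_self (n : ℕ) : transitions n 0 n = Finset.univ := by
  ext; simp [mem_transitions]

theorem transitions_succ_right {a : ℕ} {i : Fin n} (ha : a ≤ i) :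
    transitions n a (i + 1) = insert i (transitions n a i) := by
  ext; simp only [mem_transitions, Finset.mem_insert, Fin.ext_iff]; omega

theorem transitions_succ_left {b : ℕ} {i : Fin n} (hb : i < b) :
    transitions n i b = insert i (transitions n (i + 1) b) := by
  ext; simp only [mem_transitions, Finset.mem_insert, Fin.ext_iff]; omega

theorem transitions_union {a b c : ℕ} (hab : a ≤ b) (hbc : b ≤ c) :
    transitions n a b ∪ transitions n b c = transitions n a c := by
  ext; simp only [mem_transitions, Finset.mem_union]; omega

theorem disjoint_transitions (n a b c : ℕ) :
    Disjoint (transitions n a b) (transitions n b c) := by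
  rw [Finset.disjoint_left]; simp only [mem_transitions]; omega

/-- The product of the kernels `k i` over the transitions between the times `a` and `b`. -/
def chain (k : Fin n → 𝒳 × 𝒳 → ℝ≥0∞) (a b : ℕ) (x : Fin (n + 1) → 𝒳) : ℝ≥0∞ :=
  ∏ i ∈ transitions n a b, k i (x i.castSucc, x i.succ)

variable (k : Fin n → 𝒳 × 𝒳 → ℝ≥0∞)

theorem dependsOn_chain (a b : ℕ) : DependsOn (chain k a b) {j | a ≤ j.val ∧ j.val ≤ b} :=
  fun x y h => Finset.prod_congr rfl fun i hi => by
    obtain ⟨ha, hb⟩ := mem_transitions.1 hi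
    rw [h i.castSucc ⟨ha, hb.le⟩, h i.succ ⟨ha.trans (Nat.le_succ i), hb⟩]

theorem chain_self (a : ℕ) (x : Fin (n + 1) → 𝒳) : chain k a a x = 1 := by
  rw [chain, transitions_self, Finset.prod_empty]

theorem chain_zero_self (x : Fin (n + 1) → 𝒳) :
    chain k 0 n x = ∏ i, k i (x i.castSucc, x i.succ) := by
  rw [chain, transitions_zero_self]

theorem chain_succ_right {a : ℕ} {i : Fin n} (ha : a ≤ i) (x : Fin (n + 1) → 𝒳) :
    chain k a (i + 1) x = chain k a i x * k i (x i.castSucc, x i.succ) := by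
  rw [chain, transitions_succ_right ha, Finset.prod_insert (by simp [mem_transitions]), mul_comm,
    chain]

theorem chain_succ_left {b : ℕ} {i : Fin n} (hb : i < b) (x : Fin (n + 1) → 𝒳) :
    chain k i b x = chain k (i + 1) b x * k i (x i.castSucc, x i.succ) := by
  rw [chain, transitions_succ_left hb, Finset.prod_insert (by simp [mem_transitions]), mul_comm,
    chain]

theorem chain_mul_chain {a b c : ℕ} (hab : a ≤ b) (hbc : b ≤ c) (x : Fin (n + 1) → 𝒳) :
    chain k a b x * chain k b c x = chain k a c x := by
  rw [chain, chain, chain, ← Finset.prod_union (disjoint_transitions n a b c),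
    transitions_union hab hbc]

variable [MeasurableSpace 𝒳] {k}

@[fun_prop]
theorem measurable_chain (hk : ∀ i, Measurable (k i)) (a b : ℕ) : Measurable (chain k a b) := by
  unfold chain
  exact Finset.measurable_fun_prod _ fun i _ => (hk i).comp (by fun_prop)

variable (π : Measure 𝒳) [IsProbabilityMeasure π]

theorem lintegral_mul_transition_succ {i : Fin n} {f : (Fin (n + 1) → 𝒳) → ℝ≥0∞}
    {g : 𝒳 × 𝒳 → ℝ≥0∞} (hf : Measurable f) (hg : Measurable g) (hfi : DependsOn f {i.succ}ᶜ) :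
    ∫⁻ x, f x * g (x i.castSucc, x i.succ) ∂(baseline π n) =
      ∫⁻ x, f x * ∫⁻ y, g (x i.castSucc, y) ∂π ∂(baseline π n) :=
  lintegral_mul_eval_pair (fun _ => π) Fin.castSucc_lt_succ.ne hf hg hfi

theorem lintegral_mul_transition_castSucc {i : Fin n} {f : (Fin (n + 1) → 𝒳) → ℝ≥0∞}
    {g : 𝒳 × 𝒳 → ℝ≥0∞} (hf : Measurable f) (hg : Measurable g) (hfi : DependsOn f {i.castSucc}ᶜ) :
    ∫⁻ x, f x * g (x i.castSucc, x i.succ) ∂(baseline π n) =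
      ∫⁻ x, f x * ∫⁻ y, g (y, x i.succ) ∂π ∂(baseline π n) :=
  lintegral_mul_eval_pair (fun _ => π) Fin.castSucc_lt_succ.ne' hf (hg.comp measurable_swap) hfi

omit [MeasurableSpace 𝒳] in
theorem dependsOn_chain_compl_succ (i : Fin n) (a : ℕ) : DependsOn (chain k a i) {i.succ}ᶜ :=
  (dependsOn_chain k a i).mono fun j hj h => by
    rw [Set.mem_singleton_iff.1 h] at hj
    exact absurd hj.2 (Nat.not_succ_le_self i)

omit [MeasurableSpace 𝒳] in
theorem dependsOn_chain_compl_castSucc (i : Fin n) (b : ℕ) :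
    DependsOn (chain k (i + 1) b) {i.castSucc}ᶜ :=
  (dependsOn_chain k (i + 1) b).mono fun j hj h => by
    rw [Set.mem_singleton_iff.1 h] at hj
    exact absurd hj.1 (Nat.not_succ_le_self i)

theorem sq_lintegral_mul_le {α : Type*} [MeasurableSpace α] (μ : Measure α) {f g : α → ℝ≥0∞}
    (hf : AEMeasurable f μ) (hg : AEMeasurable g μ) :
    (∫⁻ a, f a * g a ∂μ) ^ 2 ≤ (∫⁻ a, f a ^ 2 ∂μ) * ∫⁻ a, g a ^ 2 ∂μ := by
  have h := ENNReal.lintegral_mul_le_Lp_mul_Lq μ Real.HolderConjugate.two_two hf hg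
  simp only [Pi.mul_apply, ENNReal.rpow_two] at h
  calc _ ≤ ((∫⁻ a, f a ^ 2 ∂μ) ^ (1 / 2 : ℝ) * (∫⁻ a, g a ^ 2 ∂μ) ^ (1 / 2 : ℝ)) ^ 2 := by
        gcongr
    _ = _ := by
        rw [mul_pow, ← ENNReal.rpow_two, ← ENNReal.rpow_two, ← ENNReal.rpow_mul,
          ← ENNReal.rpow_mul]
        norm_num

/- A chain of integral operators is bounded by the product of the Hilbert-Schmidt norms of its
kernels. -/
theorem sq_lintegral_chain_mul_le (hk : ∀ i, Measurable (k i)) (t : Fin (n + 1)) {f : 𝒳 → ℝ≥0∞}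
    (hf : Measurable f) :
    (∫⁻ x, chain k 0 t x * f (x t) ∂(baseline π n)) ^ 2 ≤
      (∏ i ∈ transitions n 0 t, ∫⁻ p, k i p ^ 2 ∂(π.prod π)) * ∫⁻ x, f x ^ 2 ∂π := by
  induction t using Fin.induction generalizing f with
  | zero =>
    simp only [Fin.val_zero, chain_self, transitions_self, Finset.prod_empty, one_mul]
    rw [(measurePreserving_eval_baseline π 0).lintegral_comp hf]
    simpa using sq_lintegral_mul_le π (aemeasurable_const (b := 1)) hf.aemeasurable
  | succ i ih =>
    have hkf : Measurable fun p : 𝒳 × 𝒳 => k i p * f p.2 := (hk i).mul (by fun_prop)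
    have hsplit : ∀ x : Fin (n + 1) → 𝒳, chain k 0 i.succ x * f (x i.succ) =
        chain k 0 i x * (k i (x i.castSucc, x i.succ) * f (x i.succ)) := fun x => by
      rw [Fin.val_succ, chain_succ_right k (Nat.zero_le _), mul_assoc]
    simp only [hsplit]
    rw [lintegral_mul_transition_succ π (measurable_chain hk 0 i) hkf
        (dependsOn_chain_compl_succ i 0), Fin.val_succ, transitions_succ_right (Nat.zero_le _),
      Finset.prod_insert (by simp [mem_transitions]), mul_comm (∫⁻ p, k i p ^ 2 ∂(π.prod π)),
      mul_assoc]
    refine (ih hkf.lintegral_prod_right').trans ?_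
    rw [Fin.val_castSucc, lintegral_prod _ ((hk i).pow_const 2).aemeasurable,
      ← lintegral_mul_const _ ((hk i).pow_const 2).lintegral_prod_right']
    gcongr with c
    exact sq_lintegral_mul_le π ((hk i).comp (by fun_prop)).aemeasurable hf.aemeasurable

theorem sq_lintegral_prod_le (hk : ∀ i, Measurable (k i)) :
    (∫⁻ x, ∏ i, k i (x i.castSucc, x i.succ) ∂(baseline π n)) ^ 2 ≤
      ∏ i, ∫⁻ p, k i p ^ 2 ∂(π.prod π) := by
  simpa [chain_zero_self, transitions_zero_self] using
    sq_lintegral_chain_mul_le π hk (Fin.last n) (f := fun _ => 1) measurable_const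

end Chain

/-! ### Conditional independence of past and future -/

section OneDependent

variable {𝒳 : Type*} [MeasurableSpace 𝒳] {n : ℕ}

theorem present_le (t : Fin (n + 1)) : present (𝒳 := 𝒳) t ≤ MeasurableSpace.pi :=
  (measurable_pi_apply t).comap_le

theorem past_le (t : Fin (n + 1)) : past (𝒳 := 𝒳) t ≤ MeasurableSpace.pi :=
  iSup_le fun s => present_le s.1

theorem future_le (t : Fin (n + 1)) : future (𝒳 := 𝒳) t ≤ MeasurableSpace.pi :=
  iSup_le fun s => present_le s.1

theorem dependsOn_indicator_preimage {ι : Type*} {α : ι → Type*} {β γ : Type*} [Zero γ]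
    {f : (∀ i, α i) → β} {s : Set ι} (hf : DependsOn f s) (A : Set β) (c : γ) :
    DependsOn ((f ⁻¹' A).indicator fun _ => c) s :=
  fun _ _ h => congrArg (A.indicator fun _ => c) (hf h)

theorem dependsOn_indicator_of_measurableSet_iSup_present {p : Fin (n + 1) → Prop}
    {A : Set (Fin (n + 1) → 𝒳)} (hA : MeasurableSet[⨆ s : {s // p s}, present s.1] A) {γ : Type*}
    [Zero γ] (c : γ) : DependsOn (A.indicator fun _ => c) {j | p j} := by
  have hle : (⨆ s : {s // p s}, present (𝒳 := 𝒳) s.1) ≤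
      MeasurableSpace.comap (fun x (s : {s // p s}) => x s.1) ⊤ := by
    refine iSup_le fun s => ?_
    rintro _ ⟨S, -, rfl⟩
    exact ⟨{r | r s ∈ S}, trivial, rfl⟩
  obtain ⟨S, -, rfl⟩ := hle A hA
  exact dependsOn_indicator_preimage (fun x y h => funext fun s => h s.1 s.2) S c

theorem condExp_indicator_comap_ae_eq {Ω : Type*} [MeasurableSpace Ω] {P : Measure Ω}
    [IsFiniteMeasure P] {X : Ω → 𝒳} (hX : Measurable X) {A : Set Ω} (hA : MeasurableSet A)
    {α : 𝒳 → ℝ≥0∞} (hα : Measurable α)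
    (h : ∀ C, MeasurableSet C → P (A ∩ X ⁻¹' C) = ∫⁻ c in C, α c ∂(P.map X)) :
    P⟦A | MeasurableSpace.comap X inferInstance⟧ =ᵐ[P] fun ω => (α (X ω)).toReal := by
  have hαX : Measurable fun ω => α (X ω) := hα.comp hX
  have hfin : ∫⁻ ω, α (X ω) ∂P ≠ ∞ := by
    rw [← lintegral_map hα hX, ← setLIntegral_univ, ← h _ MeasurableSet.univ]
    exact measure_ne_top _ _
  have hint : Integrable (fun ω => (α (X ω)).toReal) P :=
    integrable_toReal_of_lintegral_ne_top hαX.aemeasurable hfin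
  refine (ae_eq_condExp_of_forall_setIntegral_eq hX.comap_le
    ((integrable_const (1 : ℝ)).indicator hA) (fun s _ _ => hint.integrableOn) ?_ ?_).symm
  · rintro _ ⟨C, hC, rfl⟩ -
    rw [integral_toReal hαX.aemeasurable (ae_restrict_of_ae (ae_lt_top hαX hfin)),
      ← setLIntegral_map hC hα hX, ← h C hC, integral_indicator hA, integral_const]
    simp [measureReal_def, Measure.restrict_apply, hA]
  · exact (hα.ennreal_toReal.comp (comap_measurable X)).aestronglyMeasurable

theorem isOneDependent_of_measure_inter_eq {P : Measure (Fin (n + 1) → 𝒳)}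
    [IsProbabilityMeasure P] (α β : Fin (n + 1) → Set (Fin (n + 1) → 𝒳) → 𝒳 → ℝ≥0∞)
    (hα : ∀ t A, MeasurableSet A → Measurable (α t A))
    (hβ : ∀ t B, MeasurableSet B → Measurable (β t B))
    (h : ∀ t A B, MeasurableSet[past t] A → MeasurableSet[future t] B → ∀ C, MeasurableSet C →
      P (A ∩ B ∩ (fun x => x t) ⁻¹' C) = ∫⁻ c in C, α t A c * β t B c ∂(P.map fun x => x t)) :
    IsOneDependent P := by
  intro t A B hA hB
  have hmeas {A B} (hA : MeasurableSet[past t] A) (hB : MeasurableSet[future t] B) :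
      Measurable fun c => α t A c * β t B c :=
    (hα t A (past_le t A hA)).mul (hβ t B (future_le t B hB))
  have hcond {A B} (hA : MeasurableSet[past t] A) (hB : MeasurableSet[future t] B) :
      P⟦A ∩ B | present t⟧ =ᵐ[P] fun x => (α t A (x t) * β t B (x t)).toReal :=
    condExp_indicator_comap_ae_eq (measurable_pi_apply t)
      ((past_le t A hA).inter (future_le t B hB)) (hmeas hA hB) (h t A B hA hB)
  have huniv : ∀ᵐ c ∂(P.map fun x => x t), α t Set.univ c * β t Set.univ c = 1 := by
    have := Measure.isProbabilityMeasure_map (μ := P) (measurable_pi_apply t).aemeasurable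
    refine ae_eq_of_forall_setLIntegral_eq_of_sigmaFinite
      (hmeas MeasurableSet.univ MeasurableSet.univ) measurable_const fun C hC _ => ?_
    rw [← h t _ _ MeasurableSet.univ MeasurableSet.univ C hC, setLIntegral_one,
      Measure.map_apply (measurable_pi_apply t) hC, Set.univ_inter, Set.univ_inter]
  have hcA := hcond hA MeasurableSet.univ
  have hcB := hcond MeasurableSet.univ hB
  rw [Set.inter_univ] at hcA
  rw [Set.univ_inter] at hcB
  filter_upwards [hcond hA hB, hcA, hcB,
    ae_of_ae_map (measurable_pi_apply t).aemeasurable huniv] with x hxAB hxA hxB hx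
  rw [hxAB, Pi.mul_apply, hxA, hxB, ← ENNReal.toReal_mul]
  congr 1
  rw [← mul_one (α t A (x t) * β t B (x t)), ← hx]
  ring

end OneDependent

/-! ### Markov chains with a copula density -/

section Marginals

variable {α β : Type*} [MeasurableSpace α] [MeasurableSpace β] (μ : Measure α) (ν : Measure β)
  [SFinite μ] [SFinite ν] {g : α × β → ℝ≥0∞}

theorem map_fst_withDensity_prod (hg : Measurable g) :
    ((μ.prod ν).withDensity g).map Prod.fst = μ.withDensity fun x => ∫⁻ y, g (x, y) ∂ν := by
  ext S hS
  rw [Measure.map_apply measurable_fst hS, withDensity_apply _ (measurable_fst hS),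
    withDensity_apply _ hS, ← Set.prod_univ, setLIntegral_prod _ hg.aemeasurable,
    Measure.restrict_univ]

theorem map_snd_withDensity_prod (hg : Measurable g) :
    ((μ.prod ν).withDensity g).map Prod.snd = ν.withDensity fun y => ∫⁻ x, g (x, y) ∂μ := by
  ext S hS
  rw [Measure.map_apply measurable_snd hS, withDensity_apply _ (measurable_snd hS),
    withDensity_apply _ hS, ← Set.univ_prod, setLIntegral_prod_symm _ hg.aemeasurable,
    Measure.restrict_univ]

end Marginals

section ChainLaw

variable {𝒳 : Type*} [MeasurableSpace 𝒳]

/-- A joint density with respect to `π × π` of a bivariate law with marginals `π`. -/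
structure IsCopulaDensity (π : Measure 𝒳) (g : 𝒳 × 𝒳 → ℝ≥0∞) : Prop where
  measurable : Measurable g
  lintegral_fst : ∀ᵐ x ∂π, ∫⁻ y, g (x, y) ∂π = 1
  lintegral_snd : ∀ᵐ y ∂π, ∫⁻ x, g (x, y) ∂π = 1

/-- The law of the stationary Markov chain with marginal law `π` whose consecutive states have
joint density `g` with respect to `π × π`. -/
def chainLaw (π : Measure 𝒳) (n : ℕ) (g : 𝒳 × 𝒳 → ℝ≥0∞) : Measure (Fin (n + 1) → 𝒳) :=
  (baseline π n).withDensity (chain (fun _ => g) 0 n)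

variable {n : ℕ} {π : Measure 𝒳} [IsProbabilityMeasure π] {g : 𝒳 × 𝒳 → ℝ≥0∞}

theorem isCopulaDensity_iff_map_eq (hg : Measurable g) :
    IsCopulaDensity π g ↔ ((π.prod π).withDensity g).map Prod.fst = π ∧
      ((π.prod π).withDensity g).map Prod.snd = π := by
  have hdensity {f : 𝒳 → ℝ≥0∞} (hf : Measurable f) :
      π.withDensity f = π ↔ ∀ᵐ x ∂π, f x = 1 := by
    conv_lhs => rhs; rw [← withDensity_one (μ := π)]
    exact withDensity_eq_iff_of_sigmaFinite hf.aemeasurable aemeasurable_const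
  rw [map_fst_withDensity_prod π π hg, map_snd_withDensity_prod π π hg,
    hdensity hg.lintegral_prod_right', hdensity hg.lintegral_prod_left']
  exact ⟨fun h => ⟨h.2, h.3⟩, fun h => ⟨hg, h.1, h.2⟩⟩

omit [IsProbabilityMeasure π] in
theorem lintegral_chainLaw (hg : Measurable g) {f : (Fin (n + 1) → 𝒳) → ℝ≥0∞}
    (hf : Measurable f) :
    ∫⁻ x, f x ∂(chainLaw π n g) = ∫⁻ x, f x * chain (fun _ => g) 0 n x ∂(baseline π n) := by
  rw [chainLaw, lintegral_withDensity_eq_lintegral_mul _ (measurable_chain (fun _ => hg) _ _) hf]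
  simp only [Pi.mul_apply, mul_comm]

theorem lintegral_mul_transition_succ_of_isCopulaDensity (hg : IsCopulaDensity π g) {i : Fin n}
    {f : (Fin (n + 1) → 𝒳) → ℝ≥0∞} (hf : Measurable f) (hfi : DependsOn f {i.succ}ᶜ) :
    ∫⁻ x, f x * g (x i.castSucc, x i.succ) ∂(baseline π n) = ∫⁻ x, f x ∂(baseline π n) := by
  rw [lintegral_mul_transition_succ π hf hg.measurable hfi]
  refine lintegral_congr_ae ?_
  filter_upwards [(measurePreserving_eval_baseline π i.castSucc).quasiMeasurePreserving.ae
    hg.lintegral_fst] with x hx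
  rw [hx, mul_one]

theorem lintegral_mul_transition_castSucc_of_isCopulaDensity (hg : IsCopulaDensity π g)
    {i : Fin n} {f : (Fin (n + 1) → 𝒳) → ℝ≥0∞} (hf : Measurable f)
    (hfi : DependsOn f {i.castSucc}ᶜ) :
    ∫⁻ x, f x * g (x i.castSucc, x i.succ) ∂(baseline π n) = ∫⁻ x, f x ∂(baseline π n) := by
  rw [lintegral_mul_transition_castSucc π hf hg.measurable hfi]
  refine lintegral_congr_ae ?_
  filter_upwards [(measurePreserving_eval_baseline π i.succ).quasiMeasurePreserving.ae
    hg.lintegral_snd] with x hx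
  rw [hx, mul_one]

theorem lintegral_mul_chain_eq_of_dependsOn_le (hg : IsCopulaDensity π g) {a b c : ℕ}
    (hab : a ≤ b) (hbc : b ≤ c) (hcn : c ≤ n) {f : (Fin (n + 1) → 𝒳) → ℝ≥0∞} (hf : Measurable f)
    (hfb : DependsOn f {j | j.val ≤ b}) :
    ∫⁻ x, f x * chain (fun _ => g) a c x ∂(baseline π n) =
      ∫⁻ x, f x * chain (fun _ => g) a b x ∂(baseline π n) := by
  induction c, hbc using Nat.le_induction with
  | base => rfl
  | succ c hbc ih =>
    let i : Fin n := ⟨c, hcn⟩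
    have hfi : DependsOn f {i.succ}ᶜ := hfb.mono fun j hj h => by
      rw [Set.mem_singleton_iff.1 h] at hj
      exact absurd (hj.trans hbc) (Nat.not_succ_le_self c)
    have hsplit : ∀ x : Fin (n + 1) → 𝒳, chain (fun _ => g) a (c + 1) x =
        chain (fun _ => g) a c x * g (x i.castSucc, x i.succ) :=
      chain_succ_right (fun _ => g) (i := i) (hab.trans hbc)
    simp only [hsplit, ← mul_assoc]
    rw [← ih (Nat.le_of_succ_le hcn)]
    exact lintegral_mul_transition_succ_of_isCopulaDensity hg
      (hf.mul (measurable_chain (fun _ => hg.measurable) a c)) fun x y h => by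
        rw [hfi h, dependsOn_chain_compl_succ i a h]

theorem lintegral_mul_chain_eq_of_dependsOn_ge (hg : IsCopulaDensity π g) {a b c : ℕ}
    (hab : a ≤ b) (hbc : b ≤ c) (hcn : c ≤ n) {f : (Fin (n + 1) → 𝒳) → ℝ≥0∞} (hf : Measurable f)
    (hfb : DependsOn f {j | b ≤ j.val}) :
    ∫⁻ x, f x * chain (fun _ => g) a c x ∂(baseline π n) =
      ∫⁻ x, f x * chain (fun _ => g) b c x ∂(baseline π n) := by
  induction b, hab using Nat.le_induction with
  | base => rfl
  | succ b _ ih =>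
    let i : Fin n := ⟨b, hbc.trans hcn⟩
    have hfi : DependsOn f {i.castSucc}ᶜ := hfb.mono fun j hj h => by
      rw [Set.mem_singleton_iff.1 h] at hj
      exact absurd hj (Nat.not_succ_le_self b)
    rw [ih (Nat.le_of_succ_le hbc) (hfb.mono fun j hj => Nat.le_of_succ_le hj)]
    have hsplit : ∀ x : Fin (n + 1) → 𝒳, chain (fun _ => g) b c x =
        chain (fun _ => g) (b + 1) c x * g (x i.castSucc, x i.succ) :=
      chain_succ_left (fun _ => g) (i := i) hbc
    simp only [hsplit, ← mul_assoc]
    exact lintegral_mul_transition_castSucc_of_isCopulaDensity hg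
      (hf.mul (measurable_chain (fun _ => hg.measurable) (b + 1) c)) fun x y h => by
        rw [hfi h, dependsOn_chain_compl_castSucc i c h]

theorem lintegral_chainLaw_of_dependsOn (hg : IsCopulaDensity π g) {a b : ℕ} (hab : a ≤ b)
    (hbn : b ≤ n) {f : (Fin (n + 1) → 𝒳) → ℝ≥0∞} (hf : Measurable f)
    (hfab : DependsOn f {j | a ≤ j.val ∧ j.val ≤ b}) :
    ∫⁻ x, f x ∂(chainLaw π n g) = ∫⁻ x, f x * chain (fun _ => g) a b x ∂(baseline π n) := by
  rw [lintegral_chainLaw hg.measurable hf,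
    lintegral_mul_chain_eq_of_dependsOn_le hg (Nat.zero_le b) hbn le_rfl hf
      (hfab.mono fun _ h => h.2),
    lintegral_mul_chain_eq_of_dependsOn_ge hg (Nat.zero_le a) hab hbn hf
      (hfab.mono fun _ h => h.1)]

theorem map_eval_chainLaw (hg : IsCopulaDensity π g) (t : Fin (n + 1)) :
    (chainLaw π n g).map (fun x => x t) = π := by
  refine Measure.ext_of_lintegral _ fun f hf => ?_
  rw [lintegral_map hf (measurable_pi_apply t), lintegral_chainLaw_of_dependsOn hg
    (le_refl t.val) t.is_le (f := fun x => f (x t)) (by fun_prop) fun x y h =>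
      congrArg f (h t ⟨le_rfl, le_rfl⟩)]
  simp only [chain_self, mul_one]
  exact (measurePreserving_eval_baseline π t).lintegral_comp hf

theorem map_transition_chainLaw (hg : IsCopulaDensity π g) (i : Fin n) :
    (chainLaw π n g).map (fun x => (x i.castSucc, x i.succ)) = (π.prod π).withDensity g := by
  refine Measure.ext_of_lintegral _ fun f hf => ?_
  have hm : Measurable fun x : Fin (n + 1) → 𝒳 => (x i.castSucc, x i.succ) := by fun_prop
  rw [lintegral_map hf hm, lintegral_chainLaw_of_dependsOn hg (Nat.le_succ i) i.isLt
      (f := fun x => f (x i.castSucc, x i.succ)) (hf.comp hm) (fun x y h => congrArg f (Prod.ext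
        (h i.castSucc ⟨le_rfl, Nat.le_succ i⟩) (h i.succ ⟨Nat.le_succ i, le_rfl⟩))),
    lintegral_withDensity_eq_lintegral_mul _ hg.measurable hf,
    ← (measurePreserving_transition_baseline π i).lintegral_comp (hg.measurable.mul hf)]
  simp only [Nat.succ_eq_add_one, chain_succ_right _ le_rfl, chain_self, one_mul, Pi.mul_apply,
    mul_comm]

theorem isProbabilityMeasure_chainLaw (hg : IsCopulaDensity π g) :
    IsProbabilityMeasure (chainLaw π n g) := by
  have : IsProbabilityMeasure ((chainLaw π n g).map fun x => x 0) := by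
    rw [map_eval_chainLaw hg]
    infer_instance
  exact Measure.isProbabilityMeasure_of_map (fun x => x 0)

omit [MeasurableSpace 𝒳] in
theorem chain_block {m k : ℕ} (hmk : m + (k + 1) ≤ n + 1) (x : Fin (n + 1) → 𝒳) :
    chain (fun _ : Fin n => g) m (m + k) x =
      chain (fun _ : Fin k => g) 0 k fun i => x ⟨m + i, by omega⟩ := by
  rw [chain_zero_self, chain]
  refine (Finset.prod_bij (fun (i : Fin k) _ => (⟨m + i, by omega⟩ : Fin n)) ?_ ?_ ?_ ?_).symm
  · exact fun i _ => mem_transitions.2 ⟨Nat.le_add_right _ _, Nat.add_lt_add_left i.isLt m⟩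
  · intro i _ j _ hij
    simpa only [Fin.mk.injEq, Nat.add_left_cancel_iff, Fin.val_inj] using hij
  · intro j hj
    obtain ⟨hmj, hjk⟩ := mem_transitions.1 hj
    exact ⟨⟨j - m, by omega⟩, Finset.mem_univ _, Fin.ext (Nat.add_sub_cancel' hmj)⟩
  · exact fun i _ => rfl

theorem map_block_chainLaw (hg : IsCopulaDensity π g) {m k : ℕ} (hmk : m + (k + 1) ≤ n + 1) :
    (chainLaw π n g).map (fun x (i : Fin (k + 1)) => x ⟨m + i, by omega⟩) = chainLaw π k g := by
  have hinj : Function.Injective fun i : Fin (k + 1) => (⟨m + i, by omega⟩ : Fin (n + 1)) :=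
    fun i j hij => by simpa only [Fin.mk.injEq, Nat.add_left_cancel_iff, Fin.val_inj] using hij
  have hblock : MeasurePreserving (fun x (i : Fin (k + 1)) => x ⟨m + i, by omega⟩)
      (baseline π n) (baseline π k) := measurePreserving_comp_of_injective (fun _ => π) hinj
  refine Measure.ext_of_lintegral _ fun f hf => ?_
  rw [lintegral_map hf hblock.measurable, lintegral_chainLaw_of_dependsOn hg
      (Nat.le_add_right m k) (by omega)
      (f := fun x => f fun i => x ⟨m + i, by omega⟩) (hf.comp hblock.measurable) fun x y h =>
        congrArg f (funext fun i => h _ ⟨Nat.le_add_right _ _, Nat.add_le_add_left i.is_le m⟩),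
    lintegral_chainLaw hg.measurable hf,
    ← hblock.lintegral_comp (f := fun y => f y * chain (fun _ => g) 0 k y)
      (hf.mul (measurable_chain (fun _ => hg.measurable) 0 k))]
  simp only [chain_block hmk]

theorem isStationary_chainLaw (hg : IsCopulaDensity π g) : IsStationary (chainLaw π n g) := by
  intro m k hmk
  cases k with
  | zero => congr 1; funext x i; exact i.elim0
  | succ k =>
    have hzero := map_block_chainLaw (n := n) hg (m := 0) (k := k) (by omega)
    simp only [zero_add] at hzero
    rw [map_block_chainLaw hg hmk, hzero]

omit [IsProbabilityMeasure π] in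
theorem measurable_indicator_mul_chain (hg : Measurable g) {A : Set (Fin (n + 1) → 𝒳)}
    (hA : MeasurableSet A) (a b : ℕ) :
    Measurable fun x => A.indicator 1 x * chain (fun _ => g) a b x :=
  (measurable_one.indicator hA).mul (measurable_chain (fun _ => hg) a b)

theorem setLIntegral_mul_eq_setLIntegral_fiberMean_mul {t : Fin (n + 1)}
    {u v : (Fin (n + 1) → 𝒳) → ℝ≥0∞} (hu : Measurable u) (hv : Measurable v)
    (hut : DependsOn u {j | j ≤ t}) (hvt : DependsOn v {j | t ≤ j}) {C : Set 𝒳}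
    (hC : MeasurableSet C) :
    ∫⁻ x in (fun x => x t) ⁻¹' C, u x * v x ∂(baseline π n) =
      ∫⁻ c in C, fiberMean (fun _ => π) t u c * fiberMean (fun _ => π) t v c ∂π := by
  have hCm : Measurable fun x : Fin (n + 1) → 𝒳 => C.indicator (1 : 𝒳 → ℝ≥0∞) (x t) :=
    (measurable_one.indicator hC).comp (measurable_pi_apply t)
  have hum : Measurable (fiberMean (fun _ => π) t u) := measurable_fiberMean _ t hu
  have hvm : Measurable (fiberMean (fun _ => π) t v) := measurable_fiberMean _ t hv
  calc ∫⁻ x in (fun x => x t) ⁻¹' C, u x * v x ∂(baseline π n)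
      = ∫⁻ x, u x * C.indicator 1 (x t) * v x ∂(baseline π n) := by
        rw [← lintegral_indicator (measurable_pi_apply t hC)]
        refine lintegral_congr fun x => ?_
        by_cases hx : x t ∈ C <;> simp [Set.indicator, hx]
    _ = ∫⁻ x, u x * C.indicator 1 (x t) * fiberMean (fun _ => π) t v (x t) ∂(baseline π n) :=
        lintegral_mul_eq_lintegral_mul_fiberMean (fun _ => π) (S := {j | j ≤ t}) (le_refl t)
          (hu.mul hCm) hv (fun x y h => by rw [hut h, h t (le_refl t)])
          (hvt.mono fun j hj => (eq_or_lt_of_le hj).imp Eq.symm not_le_of_gt)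
    _ = ∫⁻ x, C.indicator 1 (x t) * fiberMean (fun _ => π) t v (x t) * u x ∂(baseline π n) :=
        lintegral_congr fun x => by ring
    _ = ∫⁻ x, C.indicator 1 (x t) * fiberMean (fun _ => π) t v (x t) *
          fiberMean (fun _ => π) t u (x t) ∂(baseline π n) :=
        lintegral_mul_eq_lintegral_mul_fiberMean (fun _ => π) (S := {j | t ≤ j}) (le_refl t)
          (hCm.mul (hvm.comp (measurable_pi_apply t))) hu
          (fun x y h => by rw [h t (le_refl t)])
          (hut.mono fun j hj => (eq_or_lt_of_le hj).imp id not_le_of_gt)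
    _ = _ := by
        rw [← lintegral_indicator hC, ← (measurePreserving_eval_baseline π t).lintegral_comp
          (f := C.indicator fun c => fiberMean (fun _ => π) t u c * fiberMean (fun _ => π) t v c)
          ((hum.mul hvm).indicator hC)]
        refine lintegral_congr fun x => ?_
        by_cases hx : x t ∈ C <;> simp [hx, mul_comm]

theorem measure_inter_inter_chainLaw (hg : Measurable g) {t : Fin (n + 1)}
    {A B : Set (Fin (n + 1) → 𝒳)} (hA : MeasurableSet[past t] A) (hB : MeasurableSet[future t] B)
    {C : Set 𝒳} (hC : MeasurableSet C) :
    chainLaw π n g (A ∩ B ∩ (fun x => x t) ⁻¹' C) =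
      ∫⁻ c in C, fiberMean (fun _ => π) t (fun x => A.indicator 1 x * chain (fun _ => g) 0 t x) c *
        fiberMean (fun _ => π) t (fun x => B.indicator 1 x * chain (fun _ => g) t n x) c ∂π := by
  have hAB : MeasurableSet (A ∩ B) := (past_le t A hA).inter (future_le t B hB)
  have hCt : MeasurableSet ((fun x : Fin (n + 1) → 𝒳 => x t) ⁻¹' C) := measurable_pi_apply t hC
  have hAt : DependsOn (A.indicator (1 : (Fin (n + 1) → 𝒳) → ℝ≥0∞)) {j | j < t} :=
    dependsOn_indicator_of_measurableSet_iSup_present hA 1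
  have hBt : DependsOn (B.indicator (1 : (Fin (n + 1) → 𝒳) → ℝ≥0∞)) {j | t < j} :=
    dependsOn_indicator_of_measurableSet_iSup_present hB 1
  rw [← setLIntegral_mul_eq_setLIntegral_fiberMean_mul
      (measurable_indicator_mul_chain hg (past_le t A hA) 0 t)
      (measurable_indicator_mul_chain hg (future_le t B hB) t n)
      (fun x y h => congrArg₂ (· * ·) (hAt fun j hj => h j (Set.Iio_subset_Iic_self hj))
        (dependsOn_chain _ 0 t fun j hj => h j hj.2))
      (fun x y h => congrArg₂ (· * ·) (hBt fun j hj => h j (Set.Ioi_subset_Ici_self hj))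
        (dependsOn_chain _ t n fun j hj => h j hj.1))
      hC,
    chainLaw, withDensity_apply _ (hAB.inter hCt), ← setLIntegral_indicator hAB]
  refine lintegral_congr fun x => ?_
  have hsplit := chain_mul_chain (fun _ => g) (Nat.zero_le t) t.is_le x
  by_cases hxA : x ∈ A <;> by_cases hxB : x ∈ B <;> simp [Set.indicator, hxA, hxB, hsplit]

theorem isOneDependent_chainLaw (hg : IsCopulaDensity π g) :
    IsOneDependent (chainLaw π n g) := by
  have := isProbabilityMeasure_chainLaw (n := n) hg
  refine isOneDependent_of_measure_inter_eq
    (fun t A => fiberMean (fun _ => π) t fun x => A.indicator 1 x * chain (fun _ => g) 0 t x)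
    (fun t B => fiberMean (fun _ => π) t fun x => B.indicator 1 x * chain (fun _ => g) t n x)
    (fun t A hA => measurable_fiberMean _ t (measurable_indicator_mul_chain hg.measurable hA 0 t))
    (fun t B hB => measurable_fiberMean _ t (measurable_indicator_mul_chain hg.measurable hB t n))
    fun t A B hA hB C hC => ?_
  rw [map_eval_chainLaw hg, measure_inter_inter_chainLaw hg.measurable hA hB hC]

theorem phiSq_withDensity (hg : IsCopulaDensity π g) :
    phiSq ((π.prod π).withDensity g) =
      ∫⁻ p, ENNReal.ofReal (((g p).toReal - 1) ^ 2) ∂(π.prod π) := by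
  obtain ⟨hfst, hsnd⟩ := (isCopulaDensity_iff_map_eq hg.measurable).1 hg
  rw [phiSq, hfst, hsnd, chiSq, if_pos (withDensity_absolutelyContinuous _ _)]
  refine lintegral_congr_ae ?_
  filter_upwards [Measure.rnDeriv_withDensity (π.prod π) hg.measurable] with p hp
  rw [hp]

theorem feasible_chainLaw (hg : IsCopulaDensity π g) {η : ℝ}
    (hη : ∫⁻ p, ENNReal.ofReal (((g p).toReal - 1) ^ 2) ∂(π.prod π) ≤ ENNReal.ofReal η) :
    Feasible π η (chainLaw π n g) where
  isProbabilityMeasure := isProbabilityMeasure_chainLaw hg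
  phiSq_le i := by rwa [map_transition_chainLaw hg, phiSq_withDensity hg]
  isOneDependent := isOneDependent_chainLaw hg
  isStationary := isStationary_chainLaw hg
  marginal := map_eval_chainLaw hg
  absolutelyContinuous := withDensity_absolutelyContinuous _ _

end ChainLaw

/-! ### Feasible laws are laws of Markov chains -/

section MarkovProperty

variable {𝒳 : Type*} [MeasurableSpace 𝒳] {n : ℕ}

theorem exists_measurable_measure_inter_preimage_eq {Ω : Type*} [MeasurableSpace Ω]
    (P : Measure Ω) [IsFiniteMeasure P] {X : Ω → 𝒳} (hX : Measurable X) (B : Set Ω) :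
    ∃ b : 𝒳 → ℝ≥0∞, Measurable b ∧
      ∀ C, MeasurableSet C → P (B ∩ X ⁻¹' C) = ∫⁻ c in C, b c ∂(P.map X) := by
  refine ⟨((P.restrict B).map X).rnDeriv (P.map X), Measure.measurable_rnDeriv _ _,
    fun C hC => ?_⟩
  rw [Measure.setLIntegral_rnDeriv (Measure.restrict_le_self.absolutelyContinuous.map hX),
    Measure.map_apply hX hC, Measure.restrict_apply (hX hC), Set.inter_comm]

theorem IsOneDependent.measure_inter_inter_eq {P : Measure (Fin (n + 1) → 𝒳)}
    [IsProbabilityMeasure P] (hP : IsOneDependent P) {t : Fin (n + 1)}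
    {A B : Set (Fin (n + 1) → 𝒳)} (hA : MeasurableSet[past t] A) (hB : MeasurableSet[future t] B)
    {b : 𝒳 → ℝ≥0∞} (hb : Measurable b)
    (hbB : ∀ C, MeasurableSet C →
      P (B ∩ (fun x => x t) ⁻¹' C) = ∫⁻ c in C, b c ∂(P.map fun x => x t))
    {C : Set 𝒳} (hC : MeasurableSet C) :
    P (A ∩ B ∩ (fun x => x t) ⁻¹' C) = ∫⁻ c in C, b c ∂((P.restrict A).map fun x => x t) := by
  have hA' := past_le t A hA
  have hB' := future_le t B hB
  have ht : Measurable fun x : Fin (n + 1) → 𝒳 => x t := measurable_pi_apply t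
  have hCt : MeasurableSet ((fun x : Fin (n + 1) → 𝒳 => x t) ⁻¹' C) := ht hC
  have hbt : Measurable fun x : Fin (n + 1) → 𝒳 => b (x t) := hb.comp ht
  have hfin : ∫⁻ x, b (x t) ∂P ≠ ∞ := by
    rw [← lintegral_map hb ht, ← setLIntegral_univ, ← hbB _ MeasurableSet.univ]
    exact measure_ne_top _ _
  have hint : Integrable (fun x => (b (x t)).toReal) P :=
    integrable_toReal_of_lintegral_ne_top hbt.aemeasurable hfin
  have hmul : (A.indicator fun _ => (1 : ℝ)) * (fun x => (b (x t)).toReal) =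
      A.indicator fun x => (b (x t)).toReal := by
    ext x
    by_cases hx : x ∈ A <;> simp [hx]
  have hpull := condExp_mul_of_stronglyMeasurable_right (μ := P) (m := present t)
    (f := A.indicator fun _ => (1 : ℝ))
    (hb.ennreal_toReal.comp (comap_measurable fun x : Fin (n + 1) → 𝒳 => x t)).stronglyMeasurable
    (by rw [Function.comp_def, hmul]; exact hint.indicator hA')
    ((integrable_const 1).indicator hA')
  have hcond : P⟦A ∩ B | present t⟧ =ᵐ[P] P[A.indicator fun x => (b (x t)).toReal | present t] := by
    rw [← hmul]
    filter_upwards [hP t A B hA hB, condExp_indicator_comap_ae_eq ht hB' hb hbB, hpull]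
      with x hxAB hxB hx
    rw [hxAB, Pi.mul_apply, hxB]
    exact hx.symm
  have hset := setIntegral_congr_ae hCt (hcond.mono fun x hx _ => hx)
  rw [setIntegral_condExp (present_le t) ((integrable_const 1).indicator (hA'.inter hB'))
      ⟨C, hC, rfl⟩, setIntegral_condExp (present_le t) (hint.indicator hA') ⟨C, hC, rfl⟩,
    setIntegral_indicator hA', setIntegral_indicator (hA'.inter hB'), setIntegral_const,
    smul_eq_mul, mul_one, integral_toReal hbt.aemeasurable (ae_restrict_of_ae (ae_lt_top hbt hfin)),
    measureReal_def, ENNReal.toReal_eq_toReal_iff' (measure_ne_top _ _)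
      ((setLIntegral_le_lintegral _ _).trans_lt hfin.lt_top).ne] at hset
  rw [setLIntegral_map hC hb ht, Measure.restrict_restrict hCt, Set.inter_comm _ (_ ⁻¹' C), hset]

variable {A : Fin (n + 1) → Set 𝒳}

theorem measurableSet_past_pi_Iio (hA : ∀ j, MeasurableSet (A j)) (t : Fin (n + 1)) :
    MeasurableSet[past t] ((Set.Iio t).pi A) := by
  rw [Set.pi_def]
  exact MeasurableSet.biInter (Set.to_countable _) fun j hj =>
    le_iSup (fun s : {s : Fin (n + 1) // s < t} => present (𝒳 := 𝒳) s.1) ⟨j, hj⟩ _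
      ⟨A j, hA j, rfl⟩

theorem IsOneDependent.map_restrict_pi_Iio_succ_apply {P : Measure (Fin (n + 1) → 𝒳)}
    [IsProbabilityMeasure P] (hP : IsOneDependent P) (hA : ∀ j, MeasurableSet (A j)) {i : Fin n}
    {B : Set 𝒳} (hB : MeasurableSet B) {b : 𝒳 → ℝ≥0∞} (hb : Measurable b)
    (hbB : ∀ C, MeasurableSet C → P ((fun x => x i.succ) ⁻¹' B ∩ (fun x => x i.castSucc) ⁻¹' C) =
      ∫⁻ c in C, b c ∂(P.map fun x => x i.castSucc)) :
    (P.restrict ((Set.Iio i.succ).pi A)).map (fun x => x i.succ) B =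
      ∫⁻ c in A i.castSucc, b c
        ∂((P.restrict ((Set.Iio i.castSucc).pi A)).map fun x => x i.castSucc) := by
  have hBfuture : MeasurableSet[future i.castSucc] ((fun x : Fin (n + 1) → 𝒳 => x i.succ) ⁻¹' B) :=
    le_iSup (fun s : {s : Fin (n + 1) // i.castSucc < s} => present (𝒳 := 𝒳) s.1)
      ⟨i.succ, Fin.castSucc_lt_succ⟩ _ ⟨B, hB, rfl⟩
  have hIio : Set.Iio i.succ = insert i.castSucc (Set.Iio i.castSucc) := by
    ext j
    simp only [Set.mem_Iio, Set.mem_insert_iff, Fin.lt_def, Fin.ext_iff, Fin.val_succ,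
      Fin.val_castSucc]
    omega
  rw [← hP.measure_inter_inter_eq (measurableSet_past_pi_Iio hA i.castSucc) hBfuture hb hbB
      (hA i.castSucc), Measure.map_apply (measurable_pi_apply _) hB,
    Measure.restrict_apply (measurable_pi_apply _ hB), hIio, Set.insert_pi]
  congr 1
  ext x
  simp only [Set.mem_inter_iff, Set.mem_preimage, Function.eval]
  tauto

variable {P Q : Measure (Fin (n + 1) → 𝒳)} [IsProbabilityMeasure P] [IsProbabilityMeasure Q]

theorem IsOneDependent.map_restrict_pi_Iio_eq (hP : IsOneDependent P) (hQ : IsOneDependent Q)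
    (hinit : P.map (fun x => x 0) = Q.map fun x => x 0)
    (htrans : ∀ i : Fin n,
      P.map (fun x => (x i.castSucc, x i.succ)) = Q.map fun x => (x i.castSucc, x i.succ))
    (hA : ∀ j, MeasurableSet (A j)) (t : Fin (n + 1)) :
    (P.restrict ((Set.Iio t).pi A)).map (fun x => x t) =
      (Q.restrict ((Set.Iio t).pi A)).map fun x => x t := by
  induction t using Fin.induction with
  | zero =>
    have hIio : Set.Iio (0 : Fin (n + 1)) = ∅ := Set.Iio_bot
    simpa [hIio] using hinit
  | succ i ih =>
    have hm : Measurable fun x : Fin (n + 1) → 𝒳 => (x i.castSucc, x i.succ) := by fun_prop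
    have hcur : P.map (fun x => x i.castSucc) = Q.map fun x => x i.castSucc := by
      simpa only [Measure.map_map measurable_fst hm, Function.comp_def] using
        congrArg (Measure.map Prod.fst) (htrans i)
    ext B hB
    obtain ⟨b, hb, hbB⟩ := exists_measurable_measure_inter_preimage_eq P
      (measurable_pi_apply i.castSucc) ((fun x : Fin (n + 1) → 𝒳 => x i.succ) ⁻¹' B)
    rw [hP.map_restrict_pi_Iio_succ_apply hA hB hb hbB,
      hQ.map_restrict_pi_Iio_succ_apply hA hB hb fun C hC => ?_, ih]
    have hpre : (fun x : Fin (n + 1) → 𝒳 => x i.succ) ⁻¹' B ∩ (fun x => x i.castSucc) ⁻¹' C =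
        (fun x => (x i.castSucc, x i.succ)) ⁻¹' C ×ˢ B := Set.inter_comm _ _
    rw [← hcur, ← hbB C hC, hpre, ← Measure.map_apply hm (hC.prod hB),
      ← Measure.map_apply hm (hC.prod hB), htrans]

theorem IsOneDependent.eq_of_map_transition_eq (hP : IsOneDependent P) (hQ : IsOneDependent Q)
    (hinit : P.map (fun x => x 0) = Q.map fun x => x 0)
    (htrans : ∀ i : Fin n,
      P.map (fun x => (x i.castSucc, x i.succ)) = Q.map fun x => (x i.castSucc, x i.succ)) :
    P = Q := by
  refine ext_of_generate_finite _ generateFrom_pi.symm isPiSystem_pi ?_ (by simp)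
  rintro _ ⟨A, hA, rfl⟩
  have hA : ∀ j, MeasurableSet (A j) := fun j => hA j (Set.mem_univ j)
  have huniv : Set.univ.pi A =
      (fun x => x (Fin.last n)) ⁻¹' A (Fin.last n) ∩ (Set.Iio (Fin.last n)).pi A := by
    have hinsert : (Set.univ : Set (Fin (n + 1))) = insert (Fin.last n) (Set.Iio (Fin.last n)) := by
      rw [Set.Iio_insert, ← Fin.top_eq_last, Set.Iic_top]
    rw [hinsert, Set.insert_pi]
  have hlast := congrArg (fun μ => μ (A (Fin.last n)))
    (hP.map_restrict_pi_Iio_eq hQ hinit htrans hA (Fin.last n))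
  have hm : Measurable fun x : Fin (n + 1) → 𝒳 => x (Fin.last n) := measurable_pi_apply _
  rw [huniv, ← Measure.restrict_apply (hm (hA _)), ← Measure.restrict_apply (hm (hA _)),
    ← Measure.map_apply hm (hA _), ← Measure.map_apply hm (hA _)]
  exact hlast

end MarkovProperty

section Feasible

variable {𝒳 : Type*} [MeasurableSpace 𝒳] {n : ℕ}

theorem absolutelyContinuous_of_chiSq_ne_top {α : Type*} [MeasurableSpace α] {μ ν : Measure α}
    (h : chiSq μ ν ≠ ∞) : μ ≪ ν := by
  by_contra hac
  rw [chiSq, if_neg hac] at h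
  exact h rfl

theorem IsStationary.map_transition_eq {P : Measure (Fin (n + 1) → 𝒳)} (hP : IsStationary P)
    (i j : Fin n) :
    P.map (fun x => (x i.castSucc, x i.succ)) = P.map fun x => (x j.castSucc, x j.succ) := by
  have hblock (i : Fin n) : P.map (fun x => (x i.castSucc, x i.succ)) =
      (P.map fun x (j : Fin 2) => x ⟨j, by have := i.pos; omega⟩).map fun z => (z 0, z 1) := by
    rw [← hP i 2 (by omega), Measure.map_map (by fun_prop) (by fun_prop)]
    rfl
  rw [hblock i, hblock j]

theorem Feasible.exists_eq_chainLaw {π : Measure 𝒳} [IsProbabilityMeasure π]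
    {P : Measure (Fin (n + 1) → 𝒳)} {η : ℝ} (hP : Feasible π η P) (i : Fin n) :
    ∃ g, IsCopulaDensity π g ∧
      ∫⁻ p, ENNReal.ofReal (((g p).toReal - 1) ^ 2) ∂(π.prod π) ≤ ENNReal.ofReal η ∧
      P = chainLaw π n g := by
  have := hP.isProbabilityMeasure
  have hm : Measurable fun x : Fin (n + 1) → 𝒳 => (x i.castSucc, x i.succ) := by fun_prop
  set Q := P.map fun x => (x i.castSucc, x i.succ) with hQ
  have : IsProbabilityMeasure Q := Measure.isProbabilityMeasure_map hm.aemeasurable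
  have hfst : Q.map Prod.fst = π := by
    rw [hQ, Measure.map_map measurable_fst hm]; exact hP.marginal _
  have hsnd : Q.map Prod.snd = π := by
    rw [hQ, Measure.map_map measurable_snd hm]; exact hP.marginal _
  have hφ : phiSq Q ≤ ENNReal.ofReal η := hP.phiSq_le i
  have hac : Q ≪ π.prod π := absolutelyContinuous_of_chiSq_ne_top <| by
    rw [phiSq, hfst, hsnd] at hφ
    exact (hφ.trans_lt ENNReal.ofReal_lt_top).ne
  have hg : Measurable (Q.rnDeriv (π.prod π)) := Measure.measurable_rnDeriv _ _
  have hQg : (π.prod π).withDensity (Q.rnDeriv (π.prod π)) = Q :=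
    Measure.withDensity_rnDeriv_eq _ _ hac
  have hcop : IsCopulaDensity π (Q.rnDeriv (π.prod π)) := by
    rw [isCopulaDensity_iff_map_eq hg, hQg]
    exact ⟨hfst, hsnd⟩
  have := isProbabilityMeasure_chainLaw (n := n) hcop
  refine ⟨_, hcop, by rwa [← phiSq_withDensity hcop, hQg],
    hP.isOneDependent.eq_of_map_transition_eq (isOneDependent_chainLaw hcop) ?_ fun j => ?_⟩
  · rw [hP.marginal, map_eval_chainLaw hcop]
  · rw [map_transition_chainLaw hcop, hQg, hP.isStationary.map_transition_eq j i]

end Feasible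

/-! ### The objective as a polynomial on `L²` -/

section SquareIntegrable

variable {α β : Type*} [MeasurableSpace α] [MeasurableSpace β] {μ : Measure α} {ν : Measure β}

theorem enorm_sq_eq_lintegral (f : Lp ℝ 2 μ) : ‖f‖ₑ ^ 2 = ∫⁻ a, ‖f a‖ₑ ^ 2 ∂μ := by
  rw [Lp.enorm_def, eLpNorm_eq_lintegral_rpow_enorm_toReal (by norm_num) (by norm_num),
    ← ENNReal.rpow_two, ← ENNReal.rpow_mul]
  simp

theorem norm_le_sqrt_iff_lintegral_le (f : Lp ℝ 2 μ) {η : ℝ} (hη : 0 ≤ η) :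
    ‖f‖ ≤ √η ↔ ∫⁻ a, ENNReal.ofReal (f a ^ 2) ∂μ ≤ ENNReal.ofReal η := by
  have hsq (a : α) : ENNReal.ofReal (f a ^ 2) = ‖f a‖ₑ ^ 2 := by
    rw [← ofReal_norm, ← ENNReal.ofReal_pow (norm_nonneg _), Real.norm_eq_abs, sq_abs]
  simp only [hsq, ← enorm_sq_eq_lintegral]
  rw [← ofReal_norm, ← ENNReal.ofReal_pow (norm_nonneg _), ENNReal.ofReal_le_ofReal_iff hη,
    Real.le_sqrt (norm_nonneg _) hη]

end SquareIntegrable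

section Objective

variable {𝒳 : Type*} [MeasurableSpace 𝒳] {n : ℕ} {π : Measure 𝒳} [IsProbabilityMeasure π]

theorem ae_forall_transition {p : 𝒳 × 𝒳 → Prop} (hp : ∀ᵐ q ∂(π.prod π), p q) :
    ∀ᵐ x ∂(baseline π n), ∀ i : Fin n, p (x i.castSucc, x i.succ) :=
  ae_all_iff.2 fun i => (measurePreserving_transition_baseline π i).quasiMeasurePreserving.ae hp

theorem lintegral_enorm_prod_transition_le (k : Fin n → Lp ℝ 2 (π.prod π)) :
    ∫⁻ x, ‖∏ i, k i (x i.castSucc, x i.succ)‖ₑ ∂(baseline π n) ≤ ∏ i, ‖k i‖ₑ := by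
  have hsq := sq_lintegral_prod_le π (k := fun i p => ‖k i p‖ₑ)
    fun i => (Lp.stronglyMeasurable (k i)).measurable.enorm
  simp only [← enorm_sq_eq_lintegral, Finset.prod_pow] at hsq
  simpa only [← ofReal_norm, norm_prod, ENNReal.ofReal_prod_of_nonneg fun _ _ => norm_nonneg _]
    using (ENNReal.pow_le_pow_left_iff two_ne_zero).1 hsq

theorem integrable_prod_transition (k : Fin n → Lp ℝ 2 (π.prod π)) :
    Integrable (fun x : Fin (n + 1) → 𝒳 => ∏ i, k i (x i.castSucc, x i.succ)) (baseline π n) :=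
  ⟨(Finset.measurable_fun_prod _ fun i _ =>
      (Lp.stronglyMeasurable (k i)).measurable.comp (by fun_prop)).aestronglyMeasurable,
    (lintegral_enorm_prod_transition_le k).trans_lt (ENNReal.prod_lt_top fun _ _ => enorm_lt_top)⟩

theorem integral_norm_prod_transition_le (k : Fin n → Lp ℝ 2 (π.prod π)) :
    ∫ x, ‖∏ i, k i (x i.castSucc, x i.succ)‖ ∂(baseline π n) ≤ ∏ i, ‖k i‖ := by
  rw [integral_norm_eq_lintegral_enorm (integrable_prod_transition k).1]
  refine ENNReal.toReal_le_of_le_ofReal (Finset.prod_nonneg fun _ _ => norm_nonneg _) ?_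
  rw [ENNReal.ofReal_prod_of_nonneg fun _ _ => norm_nonneg _]
  simpa only [ofReal_norm] using lintegral_enorm_prod_transition_le k

omit [IsProbabilityMeasure π] in
theorem prod_update_transition (k : Fin n → Lp ℝ 2 (π.prod π)) [DecidableEq (Fin n)] (i : Fin n)
    (w : Lp ℝ 2 (π.prod π)) (x : Fin (n + 1) → 𝒳) :
    ∏ j, Function.update k i w j (x j.castSucc, x j.succ) =
      w (x i.castSucc, x i.succ) * ∏ j ∈ Finset.univ \ {i}, k j (x j.castSucc, x j.succ) := by
  rw [← Finset.prod_update_of_mem (Finset.mem_univ i)]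
  refine Finset.prod_congr rfl fun j _ => ?_
  rcases eq_or_ne j i with rfl | hj <;> simp [*]

variable {h : (Fin (n + 1) → 𝒳) → ℝ} {C : ℝ}

theorem norm_integral_mul_prod_transition_le (hC : ∀ x, |h x| ≤ C)
    (k : Fin n → Lp ℝ 2 (π.prod π)) :
    ‖∫ x, h x * ∏ i, k i (x i.castSucc, x i.succ) ∂(baseline π n)‖ ≤ C * ∏ i, ‖k i‖ := by
  obtain ⟨x₀⟩ := nonempty_of_isProbabilityMeasure (baseline π n)
  have hC₀ : 0 ≤ C := (abs_nonneg _).trans (hC x₀)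
  calc ‖∫ x, h x * ∏ i, k i (x i.castSucc, x i.succ) ∂(baseline π n)‖
      ≤ ∫ x, C * ‖∏ i, k i (x i.castSucc, x i.succ)‖ ∂(baseline π n) :=
        norm_integral_le_of_norm_le ((integrable_prod_transition k).norm.const_mul C)
          (ae_of_all _ fun x => by rw [norm_mul]; gcongr; exact hC x)
    _ ≤ C * ∏ i, ‖k i‖ := by
        rw [integral_const_mul]
        gcongr
        exact integral_norm_prod_transition_le k

/-- The multilinear form `k ↦ E₀[h(X) ∏ᵢ kᵢ(Xᵢ, Xᵢ₊₁)]` on `L²(π × π)`, of which `objective` is an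
affine restriction. -/
def multilinearObjective (π : Measure 𝒳) [IsProbabilityMeasure π] (h_meas : Measurable h)
    (hC : ∀ x, |h x| ≤ C) :
    ContinuousMultilinearMap ℝ (fun _ : Fin n => Lp ℝ 2 (π.prod π)) ℝ :=
  have hint (k : Fin n → Lp ℝ 2 (π.prod π)) :
      Integrable (fun x => h x * ∏ i, k i (x i.castSucc, x i.succ)) (baseline π n) :=
    (integrable_prod_transition k).bdd_mul h_meas.aestronglyMeasurable (ae_of_all _ hC)
  MultilinearMap.mkContinuous
    { toFun := fun k => ∫ x, h x * ∏ i, k i (x i.castSucc, x i.succ) ∂(baseline π n)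
      map_update_add' := fun k i v w => by
        rw [← integral_add (hint _) (hint _)]
        refine integral_congr_ae ?_
        filter_upwards [ae_forall_transition (Lp.coeFn_add v w)] with x hx
        simp only [prod_update_transition, hx i, Pi.add_apply]
        ring
      map_update_smul' := fun k i c w => by
        rw [smul_eq_mul, ← integral_const_mul]
        refine integral_congr_ae ?_
        filter_upwards [ae_forall_transition (Lp.coeFn_smul c w)] with x hx
        simp only [prod_update_transition, hx i, Pi.smul_apply, smul_eq_mul]
        ring }
    C (norm_integral_mul_prod_transition_le hC)

theorem multilinearObjective_apply (h_meas : Measurable h) (hC : ∀ x, |h x| ≤ C)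
    (k : Fin n → Lp ℝ 2 (π.prod π)) :
    multilinearObjective π h_meas hC k =
      ∫ x, h x * ∏ i, k i (x i.castSucc, x i.succ) ∂(baseline π n) := rfl

/-- The mean of `h` under the Markov chain whose transitions have joint density `1 + w`. -/
def objective (π : Measure 𝒳) (h : (Fin (n + 1) → 𝒳) → ℝ) (w : Lp ℝ 2 (π.prod π)) : ℝ :=
  ∫ x, h x * ∏ i : Fin n, (1 + w (x i.castSucc, x i.succ)) ∂(baseline π n)

theorem objective_eq_multilinearObjective (h_meas : Measurable h) (hC : ∀ x, |h x| ≤ C) :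
    objective π h =
      fun w => multilinearObjective π h_meas hC fun _ => Lp.const 2 (π.prod π) 1 + w := by
  funext w
  refine integral_congr_ae ?_
  filter_upwards [ae_forall_transition (Lp.coeFn_add (Lp.const 2 (π.prod π) (1 : ℝ)) w),
    ae_forall_transition (Lp.coeFn_const 2 (π.prod π) (1 : ℝ))] with x hadd hone
  simp only [hadd, Pi.add_apply, hone, Function.const_apply]

theorem contDiff_objective (h_meas : Measurable h) (hC : ∀ x, |h x| ≤ C) :
    ContDiff ℝ 2 (objective π h) := by
  rw [objective_eq_multilinearObjective h_meas hC]
  exact (multilinearObjective π h_meas hC).contDiff.comp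
    (contDiff_pi.2 fun _ => contDiff_const.add contDiff_id)

theorem fderiv_objective_zero (h_meas : Measurable h) (hC : ∀ x, |h x| ≤ C)
    (w : Lp ℝ 2 (π.prod π)) :
    fderiv ℝ (objective π h) 0 w =
      ∑ i : Fin n, ∫ x, h x * w (x i.castSucc, x i.succ) ∂(baseline π n) := by
  have hdiag : HasFDerivAt
      (fun (w : Lp ℝ 2 (π.prod π)) (_ : Fin n) => Lp.const 2 (π.prod π) (1 : ℝ) + w)
      (ContinuousLinearMap.pi fun _ => ContinuousLinearMap.id ℝ (Lp ℝ 2 (π.prod π))) 0 :=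
    hasFDerivAt_pi.2 fun _ => (hasFDerivAt_id _).const_add _
  have hcomp := ((multilinearObjective π h_meas hC).hasFDerivAt
    (fun _ => Lp.const 2 (π.prod π) (1 : ℝ) + 0)).comp (0 : Lp ℝ 2 (π.prod π)) hdiag
  rw [objective_eq_multilinearObjective h_meas hC]
  refine (congrArg (fun f => f w) hcomp.fderiv).trans ?_
  rw [ContinuousLinearMap.comp_apply, ContinuousMultilinearMap.linearDeriv_apply]
  refine Finset.sum_congr rfl fun i _ => ?_
  rw [multilinearObjective_apply, add_zero]
  refine integral_congr_ae ?_
  filter_upwards [ae_forall_transition (Lp.coeFn_const 2 (π.prod π) (1 : ℝ))] with x hx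
  rw [prod_update_transition, Finset.prod_eq_one fun j _ => hx j, mul_one]
  rfl

end Objective

/-! ### Densities of feasible transitions -/

section DensityDeviations

section FiniteMeasure

variable {α β : Type*} [MeasurableSpace α] [MeasurableSpace β] {μ : Measure α} {ν : Measure β}

theorem ae_nonneg_one_add_iff_forall_setIntegral [IsFiniteMeasure μ] {w : α → ℝ}
    (hw : Integrable w μ) :
    (∀ᵐ a ∂μ, 0 ≤ 1 + w a) ↔ ∀ S, MeasurableSet S → -μ.real S ≤ ∫ a in S, w a ∂μ := by
  have hsplit (S : Set α) : ∫ a in S, (1 + w a) ∂μ = μ.real S + ∫ a in S, w a ∂μ := by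
    rw [integral_add (integrable_const _).integrableOn hw.integrableOn]; simp
  refine ⟨fun h0 S _ => ?_, fun hS => ae_nonneg_of_forall_setIntegral_nonneg
    ((integrable_const 1).add hw) fun S hSm _ => ?_⟩
  · have hnonneg := setIntegral_nonneg_of_ae (s := S) h0
    rw [hsplit] at hnonneg
    linarith
  · rw [hsplit]
    linarith [hS S hSm]

theorem ae_integral_prodMk_eq_zero_iff_forall_setIntegral [SFinite μ] [SFinite ν] {w : α × β → ℝ}
    (hw : Integrable w (μ.prod ν)) :
    (∀ᵐ x ∂μ, ∫ y, w (x, y) ∂ν = 0) ↔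
      ∀ S, MeasurableSet S → ∫ p in S ×ˢ Set.univ, w p ∂(μ.prod ν) = 0 := by
  have hfubini (S : Set α) :
      ∫ p in S ×ˢ Set.univ, w p ∂(μ.prod ν) = ∫ x in S, ∫ y, w (x, y) ∂ν ∂μ := by
    rw [setIntegral_prod _ hw.integrableOn]; simp
  simp only [hfubini]
  exact ⟨fun h S _ => integral_eq_zero_of_ae (ae_restrict_of_ae h), fun h =>
    hw.integral_prod_left.ae_eq_zero_of_forall_setIntegral_eq_zero fun S hS _ => h S hS⟩

theorem ae_lintegral_ofReal_one_add_prodMk_eq_one_iff [SFinite μ] [IsProbabilityMeasure ν]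
    {w : α × β → ℝ} (hw : Integrable w (μ.prod ν)) (h0 : ∀ᵐ p ∂(μ.prod ν), 0 ≤ 1 + w p) :
    (∀ᵐ x ∂μ, ∫⁻ y, ENNReal.ofReal (1 + w (x, y)) ∂ν = 1) ↔
      ∀ᵐ x ∂μ, ∫ y, w (x, y) ∂ν = 0 := by
  refine eventually_congr ?_
  filter_upwards [Measure.ae_ae_of_ae_prod h0, hw.prod_right_ae] with x hx hwx
  have hint : Integrable (fun y => 1 + w (x, y)) ν := (integrable_const 1).add hwx
  rw [← ofReal_integral_eq_lintegral_ofReal hint hx, ENNReal.ofReal_eq_one,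
    integral_add (integrable_const 1) hwx]
  simp

/-- Integration over a set as a continuous linear form on `L²`. -/
def setIntegralL2 (μ : Measure α) [IsFiniteMeasure μ] {S : Set α} (hS : MeasurableSet S) :
    Lp ℝ 2 μ →L[ℝ] ℝ :=
  innerSL ℝ (indicatorConstLp 2 hS (measure_ne_top μ S) 1)

theorem setIntegralL2_apply [IsFiniteMeasure μ] {S : Set α} (hS : MeasurableSet S)
    (w : Lp ℝ 2 μ) : setIntegralL2 μ hS w = ∫ a in S, w a ∂μ := by
  rw [setIntegralL2, innerSL_apply_apply, L2.inner_indicatorConstLp_one]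

end FiniteMeasure

variable {𝒳 : Type*} [MeasurableSpace 𝒳] {n : ℕ} {π : Measure 𝒳}

/-- The function `w` has vanishing conditional means given either coordinate, i.e. it is a
degenerate kernel in the sense of the Hoeffding decomposition. The functions `w` for which `1 + w`
has both marginals `π` are of this kind. -/
structure IsDegenerate (π : Measure 𝒳) (w : 𝒳 × 𝒳 → ℝ) : Prop where
  integral_fst : ∀ᵐ x ∂π, ∫ y, w (x, y) ∂π = 0
  integral_snd : ∀ᵐ y ∂π, ∫ x, w (x, y) ∂π = 0

/-- The functions `w` such that `1 + w` is the joint density of a law with marginals `π`. -/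
def densityDeviations (π : Measure 𝒳) : Set (Lp ℝ 2 (π.prod π)) :=
  {w | (∀ᵐ p ∂(π.prod π), 0 ≤ 1 + w p) ∧ IsDegenerate π w}

variable [IsProbabilityMeasure π]

theorem ae_swap {p : 𝒳 × 𝒳 → Prop} (hp : ∀ᵐ q ∂(π.prod π), p q) :
    ∀ᵐ q ∂(π.prod π), p q.swap :=
  Measure.measurePreserving_swap.quasiMeasurePreserving.ae hp

theorem IsDegenerate.congr_ae {v w : 𝒳 × 𝒳 → ℝ} (hv : IsDegenerate π v)
    (hvw : v =ᵐ[π.prod π] w) : IsDegenerate π w where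
  integral_fst := by
    filter_upwards [hv.integral_fst, Measure.ae_ae_of_ae_prod hvw] with x hx hxw
    rw [← hx, integral_congr_ae hxw]
  integral_snd := by
    filter_upwards [hv.integral_snd, Measure.ae_ae_of_ae_prod (ae_swap hvw)] with y hy hyw
    rw [← hy]
    exact (integral_congr_ae hyw).symm

theorem isDegenerate_iff_forall_setIntegral {w : 𝒳 × 𝒳 → ℝ} (hw : Integrable w (π.prod π)) :
    IsDegenerate π w ↔
      (∀ S, MeasurableSet S → ∫ p in S ×ˢ Set.univ, w p ∂(π.prod π) = 0) ∧
        ∀ S, MeasurableSet S → ∫ p in Set.univ ×ˢ S, w p ∂(π.prod π) = 0 := by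
  have hsnd := ae_integral_prodMk_eq_zero_iff_forall_setIntegral hw.swap
  simp only [Function.comp_apply, setIntegral_prod_swap] at hsnd
  rw [← ae_integral_prodMk_eq_zero_iff_forall_setIntegral hw, ← hsnd]
  exact ⟨fun h => ⟨h.1, h.2⟩, fun h => ⟨h.1, h.2⟩⟩

theorem isCopulaDensity_ofReal_one_add_iff {w : 𝒳 × 𝒳 → ℝ} (hwm : Measurable w)
    (hw : Integrable w (π.prod π)) (h0 : ∀ᵐ p ∂(π.prod π), 0 ≤ 1 + w p) :
    IsCopulaDensity π (fun p => ENNReal.ofReal (1 + w p)) ↔ IsDegenerate π w := by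
  have hfst := ae_lintegral_ofReal_one_add_prodMk_eq_one_iff hw h0
  have hsnd := ae_lintegral_ofReal_one_add_prodMk_eq_one_iff hw.swap (ae_swap h0)
  exact ⟨fun h => ⟨hfst.1 h.lintegral_fst, hsnd.1 h.lintegral_snd⟩, fun h =>
    ⟨(hwm.const_add 1).ennreal_ofReal, hfst.2 h.integral_fst, hsnd.2 h.integral_snd⟩⟩

theorem densityDeviations_eq_iInter : densityDeviations π =
    (⋂ (S) (hS : MeasurableSet S), setIntegralL2 (π.prod π) hS ⁻¹' Set.Ici (-(π.prod π).real S)) ∩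
      ((⋂ (S) (hS : MeasurableSet S),
        setIntegralL2 (π.prod π) (hS.prod MeasurableSet.univ) ⁻¹' {0}) ∩
      ⋂ (S) (hS : MeasurableSet S),
        setIntegralL2 (π.prod π) (MeasurableSet.univ.prod hS) ⁻¹' {0}) := by
  ext w
  have hw : Integrable w (π.prod π) := (Lp.memLp w).integrable one_le_two
  simp [densityDeviations, setIntegralL2_apply, ae_nonneg_one_add_iff_forall_setIntegral hw,
    isDegenerate_iff_forall_setIntegral hw]

theorem convex_densityDeviations : Convex ℝ (densityDeviations π) := by
  rw [densityDeviations_eq_iInter]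
  exact (convex_iInter₂ fun _ _ => (convex_Ici _).linear_preimage _).inter
    ((convex_iInter₂ fun _ _ => (convex_singleton 0).linear_preimage _).inter
      (convex_iInter₂ fun _ _ => (convex_singleton 0).linear_preimage _))

theorem isClosed_densityDeviations : IsClosed (densityDeviations π) := by
  rw [densityDeviations_eq_iInter]
  exact (isClosed_iInter fun _ => isClosed_iInter fun hS =>
      isClosed_Ici.preimage (setIntegralL2 (π.prod π) hS).continuous).inter
    ((isClosed_iInter fun _ => isClosed_iInter fun hS =>
      isClosed_singleton.preimage
        (setIntegralL2 (π.prod π) (hS.prod MeasurableSet.univ)).continuous).inter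
    (isClosed_iInter fun _ => isClosed_iInter fun hS =>
      isClosed_singleton.preimage
        (setIntegralL2 (π.prod π) (MeasurableSet.univ.prod hS)).continuous))

variable {g : 𝒳 × 𝒳 → ℝ≥0∞} {w : Lp ℝ 2 (π.prod π)}

theorem IsCopulaDensity.congr_ae {g' : 𝒳 × 𝒳 → ℝ≥0∞} (hg : IsCopulaDensity π g)
    (hg' : Measurable g') (hgg' : g =ᵐ[π.prod π] g') : IsCopulaDensity π g' := by
  rw [isCopulaDensity_iff_map_eq hg', ← withDensity_congr_ae hgg']
  exact (isCopulaDensity_iff_map_eq hg.measurable).1 hg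

theorem exists_isCopulaDensity_of_mem_densityDeviations (hw : w ∈ densityDeviations π) :
    ∃ g, IsCopulaDensity π g ∧ ∀ᵐ p ∂(π.prod π), (g p).toReal = 1 + w p :=
  ⟨fun p => ENNReal.ofReal (1 + w p),
    (isCopulaDensity_ofReal_one_add_iff (Lp.stronglyMeasurable w).measurable
      ((Lp.memLp w).integrable one_le_two) hw.1).2 hw.2,
    hw.1.mono fun _ => ENNReal.toReal_ofReal⟩

theorem IsCopulaDensity.ae_lt_top (hg : IsCopulaDensity π g) : ∀ᵐ p ∂(π.prod π), g p < ∞ := by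
  refine MeasureTheory.ae_lt_top hg.measurable ?_
  rw [lintegral_prod _ hg.measurable.aemeasurable, lintegral_congr_ae hg.lintegral_fst]
  simp

theorem IsCopulaDensity.exists_mem_densityDeviations (hg : IsCopulaDensity π g)
    (hfin : ∫⁻ p, ENNReal.ofReal (((g p).toReal - 1) ^ 2) ∂(π.prod π) ≠ ∞) :
    ∃ w ∈ densityDeviations π, ∀ᵐ p ∂(π.prod π), (g p).toReal = 1 + w p := by
  have hm : Measurable fun p => (g p).toReal - 1 := hg.measurable.ennreal_toReal.sub_const 1
  have hL2 : MemLp (fun p => (g p).toReal - 1) 2 (π.prod π) :=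
    (memLp_two_iff_integrable_sq hm.aestronglyMeasurable).2
      ⟨(hm.pow_const 2).aestronglyMeasurable, by
        rw [hasFiniteIntegral_iff_ofReal (ae_of_all _ fun p => sq_nonneg _)]
        exact hfin.lt_top⟩
  have hpos (p) : 0 ≤ 1 + ((g p).toReal - 1) := by simp
  have hdeg : IsDegenerate π fun p => (g p).toReal - 1 :=
    (isCopulaDensity_ofReal_one_add_iff hm (hL2.integrable one_le_two) (ae_of_all _ hpos)).1 <|
      hg.congr_ae (hm.const_add 1).ennreal_ofReal <| hg.ae_lt_top.mono fun p hp => by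
        simp only [add_sub_cancel, ENNReal.ofReal_toReal hp.ne]
  refine ⟨hL2.toLp _, ⟨?_, hdeg.congr_ae hL2.coeFn_toLp.symm⟩, ?_⟩
  · filter_upwards [hL2.coeFn_toLp] with p hp
    rw [hp]
    exact hpos p
  · filter_upwards [hL2.coeFn_toLp] with p hp
    rw [hp, add_sub_cancel]

theorem integral_chainLaw (hg : IsCopulaDensity π g) (h : (Fin (n + 1) → 𝒳) → ℝ) :
    ∫ x, h x ∂(chainLaw π n g) =
      ∫ x, h x * ∏ i : Fin n, (g (x i.castSucc, x i.succ)).toReal ∂(baseline π n) := by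
  have hm := measurable_chain (fun _ : Fin n => hg.measurable) 0 n
  have hfin : ∀ᵐ x ∂(baseline π n), chain (fun _ => g) 0 n x < ∞ := by
    filter_upwards [ae_forall_transition hg.ae_lt_top] with x hx
    rw [chain_zero_self]
    exact ENNReal.prod_lt_top fun i _ => hx i
  rw [chainLaw, integral_withDensity_eq_integral_toReal_smul hm hfin]
  simp only [chain_zero_self, ENNReal.toReal_prod, smul_eq_mul, mul_comm]

theorem objective_eq_integral_chainLaw (hg : IsCopulaDensity π g)
    (hgw : ∀ᵐ p ∂(π.prod π), (g p).toReal = 1 + w p) (h : (Fin (n + 1) → 𝒳) → ℝ) :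
    objective π h w = ∫ x, h x ∂(chainLaw π n g) := by
  rw [integral_chainLaw hg]
  refine integral_congr_ae ?_
  filter_upwards [ae_forall_transition hgw] with x hx
  simp only [hx]

omit [IsProbabilityMeasure π] in
theorem norm_le_sqrt_iff_lintegral_density_le
    (hgw : ∀ᵐ p ∂(π.prod π), (g p).toReal = 1 + w p) {η : ℝ} (hη : 0 ≤ η) :
    ‖w‖ ≤ √η ↔
      ∫⁻ p, ENNReal.ofReal (((g p).toReal - 1) ^ 2) ∂(π.prod π) ≤ ENNReal.ofReal η := by
  rw [norm_le_sqrt_iff_lintegral_le w hη, lintegral_congr_ae]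
  filter_upwards [hgw] with p hp
  rw [hp, add_sub_cancel_left]

theorem objectiveValues_eq_image (h : (Fin (n + 1) → 𝒳) → ℝ) (hn : 0 < n) {η : ℝ} (hη : 0 ≤ η) :
    objectiveValues π h η =
      objective π h '' (densityDeviations π ∩ Metric.closedBall 0 (√η)) := by
  ext v
  constructor
  · rintro ⟨P, hP, rfl⟩
    obtain ⟨g, hg, hgη, rfl⟩ := hP.exists_eq_chainLaw ⟨0, hn⟩
    obtain ⟨w, hw, hgw⟩ :=
      hg.exists_mem_densityDeviations (hgη.trans_lt ENNReal.ofReal_lt_top).ne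
    exact ⟨w, ⟨hw, mem_closedBall_zero_iff.2
      ((norm_le_sqrt_iff_lintegral_density_le hgw hη).2 hgη)⟩,
      objective_eq_integral_chainLaw hg hgw h⟩
  · rintro ⟨w, ⟨hw, hwη⟩, rfl⟩
    obtain ⟨g, hg, hgw⟩ := exists_isCopulaDensity_of_mem_densityDeviations hw
    exact ⟨chainLaw π n g, feasible_chainLaw hg
      ((norm_le_sqrt_iff_lintegral_density_le hgw hη).1 (mem_closedBall_zero_iff.1 hwη)),
      objective_eq_integral_chainLaw hg hgw h⟩

end DensityDeviations

/-! ### Second-order expansion of products -/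

section ProductExpansion

theorem abs_integral_le_of_forall_abs_le {α : Type*} [MeasurableSpace α] {μ : Measure α}
    [IsProbabilityMeasure μ] {f : α → ℝ} {c : ℝ} (hf : ∀ a, |f a| ≤ c) : |∫ a, f a ∂μ| ≤ c := by
  simpa using norm_integral_le_of_norm_le_const (μ := μ) (f := f) (ae_of_all _ hf)

theorem sum_sum_lt_castSucc {A : Type*} [NonUnitalNonAssocSemiring A] {n : ℕ}
    (a : Fin (n + 1) → A) :
    ∑ j, ∑ i with i < j, a i * a j =
      ∑ j : Fin n, ∑ i with i < j, a i.castSucc * a j.castSucc +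
        (∑ i : Fin n, a i.castSucc) * a (Fin.last n) := by
  simp only [Finset.sum_filter, Fin.sum_univ_castSucc, Fin.castSucc_lt_castSucc_iff,
    Fin.castSucc_lt_last, (Fin.castSucc_lt_last _).not_gt, lt_irrefl, if_true, if_false, add_zero,
    Finset.sum_mul]

theorem abs_sum_sum_lt_le {n : ℕ} {a : Fin n → ℝ} {ε : ℝ} (ha : ∀ i, |a i| ≤ ε) :
    |∑ j, ∑ i with i < j, a i * a j| ≤ 4 ^ n * ε ^ 2 := by
  have hterm (i j : Fin n) : |a i * a j| ≤ ε ^ 2 := by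
    rw [abs_mul, sq]
    exact mul_le_mul (ha i) (ha j) (abs_nonneg _) ((abs_nonneg _).trans (ha i))
  have hn : (n : ℝ) ≤ 2 ^ n := mod_cast n.lt_two_pow_self.le
  calc |∑ j, ∑ i with i < j, a i * a j|
      ≤ ∑ j, ∑ i with i < j, |a i * a j| :=
        (Finset.abs_sum_le_sum_abs _ _).trans
          (Finset.sum_le_sum fun _ _ => Finset.abs_sum_le_sum_abs _ _)
    _ ≤ ∑ j, ∑ i, |a i * a j| := Finset.sum_le_sum fun _ _ =>
        Finset.sum_le_sum_of_subset_of_nonneg (Finset.filter_subset _ _)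
          fun _ _ _ => abs_nonneg _
    _ ≤ ∑ _j : Fin n, ∑ _i : Fin n, ε ^ 2 :=
        Finset.sum_le_sum fun j _ => Finset.sum_le_sum fun i _ => hterm i j
    _ = n * n * ε ^ 2 := by simp [mul_assoc]
    _ ≤ 2 ^ n * 2 ^ n * ε ^ 2 := by gcongr
    _ = 4 ^ n * ε ^ 2 := by rw [← mul_pow]; norm_num

theorem abs_prod_one_add_sub_le {n : ℕ} {a : Fin n → ℝ} {ε : ℝ} (hε₀ : 0 ≤ ε) (hε : ε ≤ 1)
    (ha : ∀ i, |a i| ≤ ε) :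
    |∏ i, (1 + a i) - (1 + ∑ i, a i + ∑ j, ∑ i with i < j, a i * a j)| ≤ 4 ^ n * ε ^ 3 := by
  induction n with
  | zero => simpa using pow_nonneg hε₀ 3
  | succ n ih =>
    have hprod := ih (a := fun i => a i.castSucc) fun i => ha _
    have hquad := abs_sum_sum_lt_le (a := fun i : Fin n => a i.castSucc) fun i => ha _
    have hlast := ha (Fin.last n)
    rw [Fin.prod_univ_castSucc, Fin.sum_univ_castSucc, sum_sum_lt_castSucc]
    generalize ∏ i : Fin n, (1 + a i.castSucc) = p at *
    generalize ∑ i : Fin n, a i.castSucc = s at *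
    generalize ∑ j : Fin n, ∑ i with i < j, a i.castSucc * a j.castSucc = q at *
    generalize a (Fin.last n) = c at *
    have hc : |1 + c| ≤ 2 := by rw [abs_le] at hlast ⊢; constructor <;> linarith
    calc |p * (1 + c) - (1 + (s + c) + (q + s * c))|
        = |(p - (1 + s + q)) * (1 + c) + q * c| := by congr 1; ring
      _ ≤ |p - (1 + s + q)| * |1 + c| + |q| * |c| := by
          rw [← abs_mul, ← abs_mul]; exact abs_add_le _ _
      _ ≤ 4 ^ n * ε ^ 3 * 2 + 4 ^ n * ε ^ 2 * ε := by gcongr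
      _ ≤ 4 ^ (n + 1) * ε ^ 3 := by
          have : 0 ≤ 4 ^ n * ε ^ 3 := by positivity
          rw [pow_succ (4 : ℝ)]
          linarith

variable {α : Type*} [MeasurableSpace α] {μ : Measure α} {n : ℕ} {h : α → ℝ} {C ε : ℝ}
  {a : Fin n → α → ℝ}

theorem integrable_mul_prod_one_add [IsFiniteMeasure μ] (hh : Integrable h μ)
    (ha_meas : ∀ i, Measurable (a i)) (ha : ∀ i x, |a i x| ≤ ε) :
    Integrable (fun x => h x * ∏ i, (1 + a i x)) μ := by
  have hm : Measurable fun x => ∏ i, (1 + a i x) :=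
    Finset.measurable_fun_prod _ fun i _ => (ha_meas i).const_add 1
  refine hh.mul_bdd (c := ∏ _i : Fin n, (1 + ε)) hm.aestronglyMeasurable (ae_of_all _ fun x => ?_)
  rw [norm_prod]
  refine Finset.prod_le_prod (fun i _ => norm_nonneg _) fun i _ => (norm_add_le _ _).trans ?_
  rw [norm_one]
  gcongr
  exact ha i x

theorem integrable_and_integral_mul_one_add_sum_add_sum_sum (hh : Integrable h μ)
    (ha_meas : ∀ i, Measurable (a i)) (ha : ∀ i x, |a i x| ≤ ε) :
    Integrable (fun x => h x * (1 + ∑ i, a i x + ∑ j, ∑ i with i < j, a i x * a j x)) μ ∧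
    ∫ x, h x * (1 + ∑ i, a i x + ∑ j, ∑ i with i < j, a i x * a j x) ∂μ =
      ∫ x, h x ∂μ + ∑ i, ∫ x, h x * a i x ∂μ +
        ∑ j : Fin n, ∑ i with i < j, ∫ x, a i x * a j x * h x ∂μ := by
  have hlin (i) : Integrable (fun x => h x * a i x) μ :=
    hh.mul_bdd (ha_meas i).aestronglyMeasurable (ae_of_all _ (ha i))
  have hquad (i j) : Integrable (fun x => a i x * a j x * h x) μ := by
    simpa only [mul_comm, mul_left_comm] using
      (hlin j).bdd_mul (ha_meas i).aestronglyMeasurable (ae_of_all _ (ha i))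
  have hlin' : Integrable (fun x => ∑ i, h x * a i x) μ := integrable_finsetSum _ fun i _ => hlin i
  have hquad' (j) : Integrable (fun x => ∑ i with i < j, a i x * a j x * h x) μ :=
    integrable_finsetSum _ fun i _ => hquad i j
  have hquad'' : Integrable (fun x => ∑ j, ∑ i with i < j, a i x * a j x * h x) μ :=
    integrable_finsetSum _ fun j _ => hquad' j
  have hexpand (x) : h x * (1 + ∑ i, a i x + ∑ j, ∑ i with i < j, a i x * a j x) =
      h x + ∑ i, h x * a i x + ∑ j, ∑ i with i < j, a i x * a j x * h x := by
    simp only [← Finset.sum_mul, ← Finset.mul_sum]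
    ring
  simp only [hexpand]
  refine ⟨(hh.add hlin').add hquad'', ?_⟩
  rw [integral_add (f := fun x => h x + ∑ i, h x * a i x) (hh.add hlin') hquad'',
    integral_add hh hlin', integral_finsetSum _ fun i _ => hlin i,
    integral_finsetSum _ fun j _ => hquad' j]
  simp only [integral_finsetSum _ fun i _ => hquad i _]

theorem abs_integral_mul_prod_one_add_sub_le [IsProbabilityMeasure μ] (h_meas : Measurable h)
    (hC : ∀ x, |h x| ≤ C) (hε₀ : 0 ≤ ε) (hε : ε ≤ 1) (ha_meas : ∀ i, Measurable (a i))
    (ha : ∀ i x, |a i x| ≤ ε) :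
    |∫ x, h x * ∏ i, (1 + a i x) ∂μ - (∫ x, h x ∂μ + ∑ i, ∫ x, h x * a i x ∂μ +
      ∑ j : Fin n, ∑ i with i < j, ∫ x, a i x * a j x * h x ∂μ)| ≤ C * (4 ^ n * ε ^ 3) := by
  have hh : Integrable h μ := .of_bound h_meas.aestronglyMeasurable C (ae_of_all _ hC)
  obtain ⟨hint, heq⟩ :=
    integrable_and_integral_mul_one_add_sum_add_sum_sum hh ha_meas ha
  rw [← heq, ← integral_sub (integrable_mul_prod_one_add hh ha_meas ha) hint]
  refine abs_integral_le_of_forall_abs_le fun x => ?_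
  rw [← mul_sub, abs_mul]
  exact mul_le_mul (hC x) (abs_prod_one_add_sub_le hε₀ hε fun i => ha i x) (abs_nonneg _)
    ((abs_nonneg _).trans (hC x))

end ProductExpansion

/-! ### The coefficients `H` and `R` -/

theorem integral_sub_sub_add {α : Type*} [MeasurableSpace α] {μ : Measure α} {f g k l : α → ℝ}
    (hf : Integrable f μ) (hg : Integrable g μ) (hk : Integrable k μ) (hl : Integrable l μ) :
    ∫ a, (f a - g a - k a + l a) ∂μ = ∫ a, f a ∂μ - ∫ a, g a ∂μ - ∫ a, k a ∂μ + ∫ a, l a ∂μ := by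
  rw [integral_add (f := fun a => f a - g a - k a) ((hf.sub hg).sub hk) hl,
    integral_sub (f := fun a => f a - g a) (hf.sub hg) hk, integral_sub hf hg]

section Degenerate

variable {𝒳 : Type*} [MeasurableSpace 𝒳] {π : Measure 𝒳} {w : 𝒳 × 𝒳 → ℝ}

theorem IsDegenerate.const_mul (hw : IsDegenerate π w) (t : ℝ) :
    IsDegenerate π fun p => t * w p where
  integral_fst := hw.integral_fst.mono fun x hx => by rw [integral_const_mul, hx, mul_zero]
  integral_snd := hw.integral_snd.mono fun y hy => by rw [integral_const_mul, hy, mul_zero]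

theorem IsDegenerate.integral_fst_mul [SFinite π] (hw : IsDegenerate π w) (u : 𝒳 → ℝ)
    (hint : Integrable (fun p => u p.1 * w p) (π.prod π)) :
    ∫ p, u p.1 * w p ∂(π.prod π) = 0 := by
  rw [integral_prod _ hint]
  refine integral_eq_zero_of_ae (hw.integral_fst.mono fun x hx => ?_)
  simp only [integral_const_mul, hx, mul_zero, Pi.zero_apply]

theorem IsDegenerate.integral_snd_mul [SFinite π] (hw : IsDegenerate π w) (v : 𝒳 → ℝ)
    (hint : Integrable (fun p => v p.2 * w p) (π.prod π)) :
    ∫ p, v p.2 * w p ∂(π.prod π) = 0 := by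
  rw [integral_prod_symm _ hint]
  refine integral_eq_zero_of_ae (hw.integral_snd.mono fun y hy => ?_)
  simp only [integral_const_mul, hy, mul_zero, Pi.zero_apply]

end Degenerate

section Coefficients

variable {𝒳 : Type*} [MeasurableSpace 𝒳] {n : ℕ} {π : Measure 𝒳} [IsProbabilityMeasure π]
  {h : (Fin (n + 1) → 𝒳) → ℝ} {C : ℝ}

theorem measurable_condMean (h_meas : Measurable h) (i : Fin n) :
    Measurable fun p : 𝒳 × 𝒳 => condMean π h i p.1 p.2 := by
  have hupdate : Measurable fun q : (𝒳 × 𝒳) × (Fin (n + 1) → 𝒳) =>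
      Function.update (Function.update q.2 i.castSucc q.1.1) i.succ q.1.2 := by
    refine measurable_pi_lambda _ fun j => ?_
    simp only [Function.update_apply]
    split_ifs <;> fun_prop
  exact (h_meas.comp hupdate).stronglyMeasurable.integral_prod_right'.measurable

theorem abs_condMean_le (hC : ∀ x, |h x| ≤ C) (i : Fin n) (x y : 𝒳) :
    |condMean π h i x y| ≤ C :=
  abs_integral_le_of_forall_abs_le fun _ => hC _

theorem integral_mul_transition_eq_integral_condMean_mul (h_meas : Measurable h)
    (hC : ∀ x, |h x| ≤ C) (i : Fin n) {w : 𝒳 × 𝒳 → ℝ} (hwm : Measurable w)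
    (hw : Integrable w (π.prod π)) :
    ∫ x, h x * w (x i.castSucc, x i.succ) ∂(baseline π n) =
      ∫ p, condMean π h i p.1 p.2 * w p ∂(π.prod π) := by
  have htrans := measurePreserving_transition_baseline π i
  have hh : Integrable h (baseline π n) :=
    .of_bound h_meas.aestronglyMeasurable C (ae_of_all _ hC)
  have hwi : Integrable (fun x : Fin (n + 1) → 𝒳 => w (x i.castSucc, x i.succ)) (baseline π n) :=
    htrans.integrable_comp_of_integrable hw
  have hwsm : StronglyMeasurable[MeasurableSpace.comap
      (fun x : Fin (n + 1) → 𝒳 => (x i.castSucc, x i.succ)) inferInstance]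
      fun x : Fin (n + 1) → 𝒳 => w (x i.castSucc, x i.succ) :=
    (hwm.comp (comap_measurable _)).stronglyMeasurable
  have hprod : Measurable fun p : 𝒳 × 𝒳 => condMean π h i p.1 p.2 * w p :=
    (measurable_condMean h_meas i).mul hwm
  rw [← htrans.map_eq, integral_map htrans.measurable.aemeasurable hprod.aestronglyMeasurable,
    ← integral_condExp htrans.measurable.comap_le]
  refine integral_congr_ae ?_
  filter_upwards [condExp_mul_of_stronglyMeasurable_right hwsm
    (hwi.bdd_mul h_meas.aestronglyMeasurable (ae_of_all _ hC)) hh,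
    condExp_ae_eq_condMean π h h_meas ⟨C, hC⟩ i] with x hpull hcond
  rw [Pi.mul_apply, hcond] at hpull
  exact hpull

theorem measurable_H (h_meas : Measurable h) : Measurable fun p : 𝒳 × 𝒳 => H π h p.1 p.2 :=
  Finset.measurable_fun_sum _ fun i _ => measurable_condMean h_meas i

theorem abs_H_le (hC : ∀ x, |h x| ≤ C) (x y : 𝒳) : |H π h x y| ≤ n * C := by
  calc |H π h x y| ≤ ∑ i : Fin n, |condMean π h i x y| := Finset.abs_sum_le_sum_abs _ _
    _ ≤ ∑ _i : Fin n, C := Finset.sum_le_sum fun i _ => abs_condMean_le hC i x y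
    _ = n * C := by simp

theorem integrable_H (h_meas : Measurable h) (hC : ∀ x, |h x| ≤ C) :
    Integrable (fun p : 𝒳 × 𝒳 => H π h p.1 p.2) (π.prod π) :=
  .of_bound (measurable_H h_meas).aestronglyMeasurable (n * C)
    (ae_of_all _ fun p => abs_H_le hC p.1 p.2)

theorem measurable_integral_H_right (h_meas : Measurable h) :
    Measurable fun x => ∫ y, H π h x y ∂π :=
  (measurable_H h_meas).stronglyMeasurable.integral_prod_right'.measurable

theorem measurable_integral_H_left (h_meas : Measurable h) :
    Measurable fun y => ∫ x, H π h x y ∂π :=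
  (measurable_H h_meas).stronglyMeasurable.integral_prod_left'.measurable

theorem abs_integral_H_right_le (hC : ∀ x, |h x| ≤ C) (x : 𝒳) : |∫ y, H π h x y ∂π| ≤ n * C :=
  abs_integral_le_of_forall_abs_le fun y => abs_H_le hC x y

theorem abs_integral_H_left_le (hC : ∀ x, |h x| ≤ C) (y : 𝒳) : |∫ x, H π h x y ∂π| ≤ n * C :=
  abs_integral_le_of_forall_abs_le fun x => abs_H_le hC x y

theorem measurable_R (h_meas : Measurable h) : Measurable fun p : 𝒳 × 𝒳 => R π h p.1 p.2 :=
  (((measurable_H h_meas).sub ((measurable_integral_H_right h_meas).comp measurable_fst)).sub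
    ((measurable_integral_H_left h_meas).comp measurable_snd)).add_const _

theorem abs_R_le (hC : ∀ x, |h x| ≤ C) (x y : 𝒳) : |R π h x y| ≤ 4 * (n * C) := by
  have hmean : |∫ p : 𝒳 × 𝒳, H π h p.1 p.2 ∂(π.prod π)| ≤ n * C :=
    abs_integral_le_of_forall_abs_le fun p => abs_H_le hC p.1 p.2
  calc |R π h x y|
      ≤ |H π h x y| + |∫ y', H π h x y' ∂π| + |∫ x', H π h x' y ∂π| +
          |∫ p : 𝒳 × 𝒳, H π h p.1 p.2 ∂(π.prod π)| :=
        (abs_add_le _ _).trans (by gcongr; exact (abs_sub _ _).trans (by gcongr; exact abs_sub _ _))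
    _ ≤ n * C + n * C + n * C + n * C := by
        gcongr
        exacts [abs_H_le hC x y, abs_integral_H_right_le hC x, abs_integral_H_left_le hC y]
    _ = 4 * (n * C) := by ring

theorem integral_R_right (h_meas : Measurable h) (hC : ∀ x, |h x| ≤ C) (x : 𝒳) :
    ∫ y, R π h x y ∂π = 0 := by
  have hH := integrable_H (π := π) h_meas hC
  have hsection : Integrable (fun y => H π h x y) π :=
    .of_bound ((measurable_H h_meas).comp measurable_prodMk_left).aestronglyMeasurable (n * C)
      (ae_of_all _ fun y => abs_H_le hC x y)
  have hmarg : Integrable (fun y => ∫ x', H π h x' y ∂π) π := hH.integral_prod_right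
  unfold R
  rw [integral_sub_sub_add hsection (integrable_const _) hmarg (integrable_const _),
    integral_prod_symm _ hH]
  simp

theorem integral_R_left (h_meas : Measurable h) (hC : ∀ x, |h x| ≤ C) (y : 𝒳) :
    ∫ x, R π h x y ∂π = 0 := by
  have hH := integrable_H (π := π) h_meas hC
  have hsection : Integrable (fun x => H π h x y) π :=
    .of_bound ((measurable_H h_meas).comp measurable_prodMk_right).aestronglyMeasurable (n * C)
      (ae_of_all _ fun x => abs_H_le hC x y)
  have hmarg : Integrable (fun x => ∫ y', H π h x y' ∂π) π := hH.integral_prod_left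
  unfold R
  rw [integral_sub_sub_add hsection hmarg (integrable_const _) (integrable_const _),
    integral_prod _ hH]
  simp

theorem isDegenerate_R (h_meas : Measurable h) (hC : ∀ x, |h x| ≤ C) :
    IsDegenerate π fun p => R π h p.1 p.2 :=
  ⟨ae_of_all π (integral_R_right h_meas hC), ae_of_all π (integral_R_left h_meas hC)⟩

theorem memLp_R (h_meas : Measurable h) (hC : ∀ x, |h x| ≤ C) :
    MemLp (fun p : 𝒳 × 𝒳 => R π h p.1 p.2) 2 (π.prod π) :=
  .of_bound (measurable_R h_meas).aestronglyMeasurable (4 * (n * C))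
    (ae_of_all _ fun p => abs_R_le hC p.1 p.2)

theorem varR_eq_integral_sq (h_meas : Measurable h) (hC : ∀ x, |h x| ≤ C) :
    varR π h = ∫ p : 𝒳 × 𝒳, R π h p.1 p.2 ^ 2 ∂(π.prod π) := by
  refine variance_of_integral_eq_zero (measurable_R h_meas).aemeasurable ?_
  rw [integral_prod _ ((memLp_R h_meas hC).integrable one_le_two)]
  simp only [integral_R_right h_meas hC, integral_zero]

theorem integral_R_mul_of_isDegenerate (h_meas : Measurable h) (hC : ∀ x, |h x| ≤ C)
    {w : 𝒳 × 𝒳 → ℝ} (hw : Integrable w (π.prod π)) (hdeg : IsDegenerate π w) :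
    ∫ p, R π h p.1 p.2 * w p ∂(π.prod π) = ∫ p, H π h p.1 p.2 * w p ∂(π.prod π) := by
  have hH := hw.bdd_mul (measurable_H (π := π) h_meas).aestronglyMeasurable
    (ae_of_all _ fun p => abs_H_le hC p.1 p.2)
  have hright : Integrable (fun p => (∫ y, H π h p.1 y ∂π) * w p) (π.prod π) :=
    hw.bdd_mul ((measurable_integral_H_right h_meas).comp measurable_fst).aestronglyMeasurable
      (ae_of_all _ fun p => abs_integral_H_right_le hC p.1)
  have hleft : Integrable (fun p => (∫ x, H π h x p.2 ∂π) * w p) (π.prod π) :=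
    hw.bdd_mul ((measurable_integral_H_left h_meas).comp measurable_snd).aestronglyMeasurable
      (ae_of_all _ fun p => abs_integral_H_left_le hC p.2)
  have hconst := hw.const_mul (∫ p, H π h p.1 p.2 ∂(π.prod π))
  simp only [R, add_mul, sub_mul]
  rw [integral_sub_sub_add hH hright hleft hconst,
    hdeg.integral_fst_mul (fun x => ∫ y, H π h x y ∂π) hright,
    hdeg.integral_snd_mul (fun y => ∫ x, H π h x y ∂π) hleft,
    hdeg.integral_fst_mul (fun _ => ∫ p, H π h p.1 p.2 ∂(π.prod π)) hconst]
  simp only [sub_zero, add_zero]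

/-- `R` as a vector of `L²(π × π)`, the gradient of the objective along degenerate directions. -/
def RLp (π : Measure 𝒳) [IsProbabilityMeasure π] (h_meas : Measurable h) (hC : ∀ x, |h x| ≤ C) :
    Lp ℝ 2 (π.prod π) :=
  (memLp_R h_meas hC).toLp

theorem coeFn_RLp (h_meas : Measurable h) (hC : ∀ x, |h x| ≤ C) :
    RLp π h_meas hC =ᵐ[π.prod π] fun p => R π h p.1 p.2 :=
  (memLp_R h_meas hC).coeFn_toLp

theorem coeFn_smul_RLp (h_meas : Measurable h) (hC : ∀ x, |h x| ≤ C) (t : ℝ) :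
    t • RLp π h_meas hC =ᵐ[π.prod π] fun p => t * R π h p.1 p.2 := by
  filter_upwards [Lp.coeFn_smul t (RLp π h_meas hC), coeFn_RLp h_meas hC] with p hsmul hp
  rw [hsmul, Pi.smul_apply, hp, smul_eq_mul]

theorem inner_RLp (h_meas : Measurable h) (hC : ∀ x, |h x| ≤ C) (w : Lp ℝ 2 (π.prod π)) :
    inner ℝ (RLp π h_meas hC) w = ∫ p, R π h p.1 p.2 * w p ∂(π.prod π) := by
  rw [L2.inner_def]
  refine integral_congr_ae ?_
  filter_upwards [coeFn_RLp h_meas hC] with p hp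
  rw [hp, RCLike.inner_apply, conj_trivial, mul_comm]

theorem norm_RLp_sq (h_meas : Measurable h) (hC : ∀ x, |h x| ≤ C) :
    ‖RLp π h_meas hC‖ ^ 2 = varR π h := by
  rw [varR_eq_integral_sq h_meas hC, ← real_inner_self_eq_norm_sq, inner_RLp]
  refine integral_congr_ae ?_
  filter_upwards [coeFn_RLp h_meas hC] with p hp
  rw [hp, sq]

theorem norm_RLp (h_meas : Measurable h) (hC : ∀ x, |h x| ≤ C) :
    ‖RLp π h_meas hC‖ = Xi₁ π h := by
  rw [Xi₁, ← norm_RLp_sq h_meas hC, Real.sqrt_sq (norm_nonneg _)]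

theorem smul_RLp_mem_densityDeviations (h_meas : Measurable h) (hC : ∀ x, |h x| ≤ C) {t : ℝ}
    (ht₀ : 0 ≤ t) (ht : t * (4 * (n * C)) ≤ 1) :
    t • RLp π h_meas hC ∈ densityDeviations π := by
  have hsmul := coeFn_smul_RLp (π := π) h_meas hC t
  refine ⟨?_, ((isDegenerate_R h_meas hC).const_mul t).congr_ae hsmul.symm⟩
  filter_upwards [hsmul] with p hp
  rw [hp]
  nlinarith [abs_le.1 (abs_R_le (π := π) hC p.1 p.2)]

theorem fderiv_objective_zero_eq_inner (h_meas : Measurable h) (hC : ∀ x, |h x| ≤ C)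
    {w : Lp ℝ 2 (π.prod π)} (hw : IsDegenerate π w) :
    fderiv ℝ (objective π h) 0 w = inner ℝ (RLp π h_meas hC) w := by
  have hwi : Integrable w (π.prod π) := (Lp.memLp w).integrable one_le_two
  have hwm : Measurable w := (Lp.stronglyMeasurable w).measurable
  calc fderiv ℝ (objective π h) 0 w
      = ∑ i, ∫ p, condMean π h i p.1 p.2 * w p ∂(π.prod π) := by
        rw [fderiv_objective_zero h_meas hC]
        exact Finset.sum_congr rfl fun i _ =>
          integral_mul_transition_eq_integral_condMean_mul h_meas hC i hwm hwi
    _ = ∫ p, H π h p.1 p.2 * w p ∂(π.prod π) := by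
        simp only [H, Finset.sum_mul]
        exact (integral_finsetSum _ fun i _ => hwi.bdd_mul
          (measurable_condMean h_meas i).aestronglyMeasurable
          (ae_of_all _ fun p => abs_condMean_le hC i p.1 p.2)).symm
    _ = inner ℝ (RLp π h_meas hC) w := by
        rw [inner_RLp, integral_R_mul_of_isDegenerate h_meas hC hwi hw]

theorem varR_eq_sum_integral (h_meas : Measurable h) (hC : ∀ x, |h x| ≤ C) :
    varR π h = ∑ i : Fin n, ∫ x, h x * R π h (x i.castSucc) (x i.succ) ∂(baseline π n) := by
  rw [← norm_RLp_sq h_meas hC, ← real_inner_self_eq_norm_sq, ← fderiv_objective_zero_eq_inner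
    h_meas hC ((isDegenerate_R h_meas hC).congr_ae (coeFn_RLp h_meas hC).symm),
    fderiv_objective_zero h_meas hC]
  refine Finset.sum_congr rfl fun i _ => integral_congr_ae ?_
  filter_upwards [ae_forall_transition (coeFn_RLp h_meas hC)] with x hx
  rw [hx i]

theorem objective_smul_RLp (h_meas : Measurable h) (hC : ∀ x, |h x| ≤ C) (t : ℝ) :
    objective π h (t • RLp π h_meas hC) =
      ∫ x, h x * ∏ i : Fin n, (1 + t * R π h (x i.castSucc) (x i.succ)) ∂(baseline π n) := by
  refine integral_congr_ae ?_
  filter_upwards [ae_forall_transition (coeFn_smul_RLp h_meas hC t)] with x hx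
  simp only [hx]

theorem abs_objective_smul_RLp_sub_le (h_meas : Measurable h) (hC : ∀ x, |h x| ≤ C)
    (h_var : varR π h ≠ 0) {t : ℝ} (ht₀ : 0 ≤ t) (ht : t * (4 * (n * C)) ≤ 1) :
    |objective π h (t • RLp π h_meas hC) -
      (∫ x, h x ∂(baseline π n) + t * varR π h + t ^ 2 * (Xi₂ π h * varR π h))| ≤
      C * (4 ^ n * (t * (4 * (n * C))) ^ 3) := by
  have hR_meas (i : Fin n) :
      Measurable fun x : Fin (n + 1) → 𝒳 => R π h (x i.castSucc) (x i.succ) :=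
    Measurable.comp (g := fun p : 𝒳 × 𝒳 => R π h p.1 p.2)
      (f := fun x : Fin (n + 1) → 𝒳 => (x i.castSucc, x i.succ)) (measurable_R h_meas)
      (measurePreserving_transition_baseline π i).measurable
  have hbound (i : Fin n) (x : Fin (n + 1) → 𝒳) :
      |t * R π h (x i.castSucc) (x i.succ)| ≤ t * (4 * (n * C)) := by
    rw [abs_mul, abs_of_nonneg ht₀]
    exact mul_le_mul_of_nonneg_left (abs_R_le hC _ _) ht₀
  obtain ⟨x₀⟩ := nonempty_of_isProbabilityMeasure (baseline π n)
  have hC₀ : 0 ≤ C := (abs_nonneg _).trans (hC x₀)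
  have hexp := abs_integral_mul_prod_one_add_sub_le (μ := baseline π n) h_meas hC
    (by positivity) ht (fun i => (hR_meas i).const_mul t) hbound
  have hlin (i : Fin n) : ∫ x, h x * (t * R π h (x i.castSucc) (x i.succ)) ∂(baseline π n) =
      t * ∫ x, h x * R π h (x i.castSucc) (x i.succ) ∂(baseline π n) := by
    simp only [← integral_const_mul, mul_left_comm]
  have hquad (i j : Fin n) : ∫ x, t * R π h (x i.castSucc) (x i.succ) *
      (t * R π h (x j.castSucc) (x j.succ)) * h x ∂(baseline π n) = t ^ 2 *
      ∫ x, R π h (x i.castSucc) (x i.succ) * R π h (x j.castSucc) (x j.succ) * h x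
        ∂(baseline π n) := by
    simp only [← integral_const_mul, mul_mul_mul_comm t, ← sq, mul_assoc]
  simp only [hlin, hquad, ← Finset.mul_sum] at hexp
  rwa [objective_smul_RLp, Xi₂, div_mul_cancel₀ _ h_var, varR_eq_sum_integral h_meas hC]

end Coefficients

/-! ### The expansions of the extremal values -/

theorem tendsto_sqrt_nhdsGT_zero : Tendsto (fun η : ℝ => √η) (𝓝[>] 0) (𝓝[>] 0) :=
  tendsto_nhdsWithin_iff.2 ⟨(Real.continuous_sqrt.tendsto' 0 0 Real.sqrt_zero).mono_left
    nhdsWithin_le_nhds, eventually_mem_nhdsWithin.mono fun _ => Real.sqrt_pos.2⟩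

theorem sqrt_pow_three {η : ℝ} (hη : 0 ≤ η) : √η ^ 3 = η ^ (3 / 2 : ℝ) := by
  rw [Real.sqrt_eq_rpow, ← Real.rpow_mul_natCast hη]
  norm_num

section Expansion

variable {𝒳 : Type*} [MeasurableSpace 𝒳] {n : ℕ} {π : Measure 𝒳} {h : (Fin (n + 1) → 𝒳) → ℝ}

theorem pos_of_varR_pos (h_var : 0 < varR π h) : 0 < n := by
  rcases Nat.eq_zero_or_pos n with rfl | hn
  · have hR : (fun p : 𝒳 × 𝒳 => R π h p.1 p.2) = 0 := funext fun p => by simp [R, H]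
    simp [varR, hR] at h_var
  · exact hn

theorem condMean_neg (i : Fin n) (x y : 𝒳) :
    condMean π (fun x => -h x) i x y = -condMean π h i x y := by
  simp only [condMean, integral_neg]

theorem R_neg (x y : 𝒳) : R π (fun x => -h x) x y = -R π h x y := by
  have hH (x y : 𝒳) : H π (fun x => -h x) x y = -H π h x y := by
    simp only [H, condMean_neg, Finset.sum_neg_distrib]
  simp only [R, hH, integral_neg]
  ring

theorem varR_neg : varR π (fun x => -h x) = varR π h := by
  simp only [varR, R_neg]
  exact variance_neg

theorem Xi₁_neg : Xi₁ π (fun x => -h x) = Xi₁ π h := by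
  rw [Xi₁, varR_neg, Xi₁]

theorem Xi₂_neg : Xi₂ π (fun x => -h x) = -Xi₂ π h := by
  simp only [Xi₂, varR_neg, R_neg, mul_neg, neg_mul, neg_neg, integral_neg, Finset.sum_neg_distrib,
    neg_div]

theorem objectiveValues_neg (η : ℝ) :
    objectiveValues π (fun x => -h x) η = -objectiveValues π h η := by
  ext v
  simp only [objectiveValues, integral_neg, Set.mem_neg, Set.mem_ofPred_eq, neg_eq_iff_eq_neg]

theorem minValue_eq_neg_maxValue_neg (η : ℝ) :
    minValue π h η = -maxValue π (fun x => -h x) η := by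
  rw [minValue, maxValue, objectiveValues_neg, Real.sInf_def]

variable [IsProbabilityMeasure π] {C : ℝ}

theorem exists_eventually_isGreatest_maxValue_and_abs_sub_le (h_meas : Measurable h)
    (hC : ∀ x, |h x| ≤ C) (h_var : 0 < varR π h) :
    ∃ D : ℝ, ∀ᶠ η in 𝓝[>] (0 : ℝ), IsGreatest (objectiveValues π h η) (maxValue π h η) ∧
      |maxValue π h η - objective π h ((√η / Xi₁ π h) • RLp π h_meas hC)| ≤ D * √η ^ 3 := by
  have hX : 0 < Xi₁ π h := Real.sqrt_pos.2 h_var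
  have hr : RLp π h_meas hC ≠ 0 := norm_pos_iff.1 <| by rwa [norm_RLp]
  obtain ⟨x₀⟩ := nonempty_of_isProbabilityMeasure (baseline π n)
  have hM : 0 ≤ 4 * (n * C) := by
    have := (abs_nonneg _).trans (hC x₀)
    positivity
  obtain ⟨D, hD⟩ := exists_isMaxOn_inter_closedBall_le (contDiff_objective h_meas hC)
    convex_densityDeviations isClosed_densityDeviations hr
    (fun w hw => fderiv_objective_zero_eq_inner h_meas hC hw.2)
    (t₀ := 1 / (4 * (n * C) + 1)) (by positivity) fun t ht₀ ht => by
      rw [le_div_iff₀ (by positivity)] at ht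
      exact smul_RLp_mem_densityDeviations h_meas hC ht₀ (by linarith)
  refine ⟨D, ?_⟩
  filter_upwards [tendsto_sqrt_nhdsGT_zero.eventually hD, eventually_mem_nhdsWithin]
    with η ⟨hzK, w, hw, hw_max, hw_le⟩ hη
  rw [norm_RLp] at hzK hw_le
  have hgreatest : IsGreatest (objectiveValues π h η) (objective π h w) := by
    rw [objectiveValues_eq_image h (pos_of_varR_pos h_var) (Set.mem_Ioi.1 hη).le]
    exact ⟨Set.mem_image_of_mem _ hw, Set.forall_mem_image.2 fun v hv => hw_max hv⟩
  have hz : (√η / Xi₁ π h) • RLp π h_meas hC ∈ Metric.closedBall 0 √η := by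
    rw [mem_closedBall_zero_iff, norm_smul, norm_RLp, Real.norm_of_nonneg (by positivity),
      div_mul_cancel₀ _ hX.ne']
  have hmax : maxValue π h η = objective π h w := hgreatest.csSup_eq
  refine ⟨hmax ▸ hgreatest, ?_⟩
  rw [hmax, abs_of_nonneg (sub_nonneg.2 (hw_max ⟨hzK, hz⟩))]
  linarith

theorem exists_eventually_abs_objective_sqrt_smul_RLp_sub_le (h_meas : Measurable h)
    (hC : ∀ x, |h x| ≤ C) (h_var : 0 < varR π h) :
    ∃ D : ℝ, ∀ᶠ η in 𝓝[>] (0 : ℝ), |objective π h ((√η / Xi₁ π h) • RLp π h_meas hC) -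
      (∫ x, h x ∂(baseline π n) + Xi₁ π h * √η + Xi₂ π h * η)| ≤ D * √η ^ 3 := by
  have hX : 0 < Xi₁ π h := Real.sqrt_pos.2 h_var
  have hX_sq : varR π h = Xi₁ π h ^ 2 := (Real.sq_sqrt h_var.le).symm
  have hsmall : ∀ᶠ η in 𝓝[>] (0 : ℝ), √η / Xi₁ π h * (4 * (n * C)) < 1 := by
    have hlim : Tendsto (fun η => √η / Xi₁ π h * (4 * (n * C))) (𝓝[>] 0)
        (𝓝 (0 / Xi₁ π h * (4 * (n * C)))) :=
      ((tendsto_nhds_of_tendsto_nhdsWithin tendsto_sqrt_nhdsGT_zero).div_const _).mul_const _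
    exact hlim.eventually_lt_const (by simp)
  refine ⟨C * (4 ^ n * (4 * (n * C) / Xi₁ π h) ^ 3), ?_⟩
  filter_upwards [hsmall, eventually_mem_nhdsWithin] with η hη_small hη
  have hexp := abs_objective_smul_RLp_sub_le h_meas hC h_var.ne' (by positivity) hη_small.le
  have hlin : √η / Xi₁ π h * varR π h = Xi₁ π h * √η := by
    rw [hX_sq]
    field_simp
  have hquad : (√η / Xi₁ π h) ^ 2 * (Xi₂ π h * varR π h) = Xi₂ π h * η := by
    rw [hX_sq, div_pow, Real.sq_sqrt (Set.mem_Ioi.1 hη).le]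
    field_simp
  rw [hlin, hquad] at hexp
  exact hexp.trans_eq (by ring)

theorem maxValue_expansion (h_meas : Measurable h) (h_bdd : ∃ C : ℝ, ∀ x, |h x| ≤ C)
    (h_var : 0 < varR π h) :
    (∀ᶠ η in 𝓝[>] (0 : ℝ), IsGreatest (objectiveValues π h η) (maxValue π h η)) ∧
      (fun η : ℝ => maxValue π h η - (∫ x, h x ∂(baseline π n) + Xi₁ π h * √η + Xi₂ π h * η))
        =O[𝓝[>] (0 : ℝ)] fun η : ℝ => η ^ (3 / 2 : ℝ) := by
  obtain ⟨C, hC⟩ := h_bdd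
  obtain ⟨D₁, hD₁⟩ := exists_eventually_isGreatest_maxValue_and_abs_sub_le h_meas hC h_var
  obtain ⟨D₂, hD₂⟩ := exists_eventually_abs_objective_sqrt_smul_RLp_sub_le h_meas hC h_var
  refine ⟨hD₁.mono fun η hη => hη.1, IsBigO.of_bound (D₁ + D₂) ?_⟩
  filter_upwards [hD₁, hD₂, eventually_mem_nhdsWithin] with η hη₁ hη₂ hη
  rw [Real.norm_eq_abs, Real.norm_of_nonneg (Real.rpow_nonneg (Set.mem_Ioi.1 hη).le _),
    ← sqrt_pow_three (Set.mem_Ioi.1 hη).le, add_mul]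
  exact (abs_sub_le _ _ _).trans (add_le_add hη₁.2 hη₂)

theorem minValue_expansion (h_meas : Measurable h) (h_bdd : ∃ C : ℝ, ∀ x, |h x| ≤ C)
    (h_var : 0 < varR π h) :
    (∀ᶠ η in 𝓝[>] (0 : ℝ), IsLeast (objectiveValues π h η) (minValue π h η)) ∧
      (fun η : ℝ => minValue π h η - (∫ x, h x ∂(baseline π n) - Xi₁ π h * √η + Xi₂ π h * η))
        =O[𝓝[>] (0 : ℝ)] fun η : ℝ => η ^ (3 / 2 : ℝ) := by
  obtain ⟨hgreatest, hbound⟩ := maxValue_expansion (π := π) (h := fun x => -h x) h_meas.neg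
    (by simpa only [abs_neg] using h_bdd) (by rwa [varR_neg])
  refine ⟨hgreatest.mono fun η hη => ?_, hbound.neg_left.congr_left fun η => ?_⟩
  · rw [minValue_eq_neg_maxValue_neg, ← neg_neg (objectiveValues π h η), ← objectiveValues_neg]
    exact ⟨Set.neg_mem_neg.2 hη.1, fun v hv => neg_le.1 (hη.2 hv)⟩
  · rw [minValue_eq_neg_maxValue_neg, Xi₁_neg, Xi₂_neg, integral_neg]
    ring

end Expansion

end SerialDependency

end

theorem theorem1 {𝒳 : Type*} [MeasurableSpace 𝒳] (π : Measure 𝒳) [IsProbabilityMeasure π]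
    (n : ℕ) (h : (Fin (n + 1) → 𝒳) → ℝ) (h_meas : Measurable h)
    (h_bdd : ∃ C : ℝ, ∀ x, |h x| ≤ C) (h_var : 0 < SerialDependency.varR π h) :
    ((∀ᶠ η in 𝓝[>] (0 : ℝ),
        IsGreatest (SerialDependency.objectiveValues π h η) (SerialDependency.maxValue π h η)) ∧
      (fun η : ℝ => SerialDependency.maxValue π h η -
          (∫ x, h x ∂(SerialDependency.baseline π n) + SerialDependency.Xi₁ π h * √η +
            SerialDependency.Xi₂ π h * η))
        =O[𝓝[>] (0 : ℝ)] fun η : ℝ => η ^ (3 / 2 : ℝ)) ∧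
    ((∀ᶠ η in 𝓝[>] (0 : ℝ),
        IsLeast (SerialDependency.objectiveValues π h η) (SerialDependency.minValue π h η)) ∧
      (fun η : ℝ => SerialDependency.minValue π h η -
          (∫ x, h x ∂(SerialDependency.baseline π n) - SerialDependency.Xi₁ π h * √η +
            SerialDependency.Xi₂ π h * η))
        =O[𝓝[>] (0 : ℝ)] fun η : ℝ => η ^ (3 / 2 : ℝ)) :=
  ⟨SerialDependency.maxValue_expansion h_meas h_bdd h_var,
    SerialDependency.minValue_expansion h_meas h_bdd h_var⟩
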